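/- Setup. Let $n\ge 1$ and let $V$ be an $n$-dimensional real affine space. A polytope $P\subset V$ is a compact set with non-empty interior $P^\circ$ that is an intersection of finitely many half spaces; it is simple if each of its vertices lies on exactly $n$ facets. A flat measure on a polytope or on a facet is the restriction to it of a translation invariant measure, positive on non-empty open sets and finite on compact sets, of $V$ or of the hyperplane containing the facet, respectively; a flat measure on the boundary $\partial P$ is a measure on $\partial P$ whose restriction to each facet is flat. Let $P$ be a simple polytope, $d\mu$ a flat measure on $P$ and $d\sigma$ a flat measure on $\partial P$. Write $L^q(P)=L^q(P,d\mu)$, and put $\frac{n}{n-1}=\infty$ when $n=1$; $L^0$-convergence means convergence in measure, and $0\cdot\infty=0$. Theorem. (a) There is a lower semicontinuous (lsc) convex function $U:P\to[0,\infty]$ with $U\in L^q(P)$ for every $q<\frac{n}{n-1}$ such that $$u(x)\le\Big(\int_{\partial P}u\,d\sigma\Big)\cdot U(x)$$ for every lsc convex function $u:P\to[0,\infty]$ and every $x\in P$. (b) Let $u_i:P\to[0,\infty]$, $i\in\mathbb N$, be convex functions (not necessarily lsc) with a uniform bound $\int_{\partial P}u_i\,d\sigma\le C<\infty$. Then all $u_i$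 lie in $L^{\frac{n}{n-1}}(P)$, and after passing to a subsequence there is an lsc convex function $u:P\to[0,\infty]$ in $L^{\frac{n}{n-1}}(P)$ such that $u_i\to u$ in $L^q(P)$ for every $q\in[0,\frac{n}{n-1})$. The functions $u_i$ and $u$ are finite on $P^\circ$, and $u_i\to u$ uniformly on every compact subset of $P^\circ$. Moreover $u$ is unique: any lsc convex function $P\to[0,\infty]$ to which the subsequence converges in $L^q(P)$ for some $q\in[0,\frac{n}{n-1})$ equals $u$ everywhere on $P$. -/

import Mathlib

open MeasureTheory Filter Topology Module
open scoped ENNReal NNReal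

namespace FlatPolytope

variable {E : Type*} [NormedAddCommGroup E] [NormedSpace ℝ E]

/-- The half space `ℓ⁻¹([0, ∞))` of an affine function `ℓ`. -/
def halfSpace (ℓ : E →ᵃ[ℝ] ℝ) : Set E := {x | 0 ≤ ℓ x}

/-- A (convex, full-dimensional) polytope: a compact set with non-empty interior which is the
intersection of finitely many half spaces of non-zero affine functions. -/
structure IsPolytope (P : Set E) : Prop where
  isCompact : IsCompact P
  nonempty_interior : (interior P).Nonempty
  exists_halfSpaces : ∃ L : Set (E →ᵃ[ℝ] ℝ), L.Finite ∧ (∀ ℓ ∈ L, ℓ ≠ 0) ∧ P = ⋂ ℓ ∈ L, halfSpace ℓ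

/-- A face of `P`: the intersection of `P` with the boundary hyperplane of a half space that
contains `P`. -/
def IsFace (P F : Set E) : Prop :=
  ∃ ℓ : E →ᵃ[ℝ] ℝ, ℓ ≠ 0 ∧ P ⊆ halfSpace ℓ ∧ F = P ∩ {x | ℓ x = 0}

/-- A facet of `P`: a (non-empty) face whose affine span has codimension one. -/
def IsFacet (P Q : Set E) : Prop :=
  IsFace P Q ∧ Q.Nonempty ∧ finrank ℝ (vectorSpan ℝ Q) + 1 = finrank ℝ E

/-- A polytope is simple if each of its vertices (one-point faces) lies on exactly `dim E`
facets. -/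
def IsSimple (P : Set E) : Prop :=
  ∀ v : E, IsFace P {v} → {Q : Set E | IsFacet P Q ∧ v ∈ Q}.encard = (finrank ℝ E : ℕ∞)

variable [MeasurableSpace E] [BorelSpace E]

/-- A flat measure on a full-dimensional polytope `P`: the restriction to `P` of a translation
invariant measure that is positive on non-empty open sets and finite on compact sets. -/
def IsFlatMeasure (P : Set E) (μ : Measure E) : Prop :=
  ∃ ν : Measure E, ν.IsAddHaarMeasure ∧ μ = ν.restrict P

/-- `σ` restricts to a flat measure on `Q`: on `Q` it is a translation invariant measure of the
affine span `x₀ + vectorSpan ℝ Q` of `Q`, positive on non-empty relatively open sets and finite on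
compact sets. -/
def RestrictsToFlat (Q : Set E) (σ : Measure E) : Prop :=
  ∃ x₀ ∈ Q, ∃ ν : Measure (vectorSpan ℝ Q), ν.IsAddHaarMeasure ∧
    σ.restrict Q = (ν.map (fun w : vectorSpan ℝ Q => (w : E) + x₀)).restrict Q

/-- A flat measure on the topological boundary of `P`: a measure carried by `frontier P` whose
restriction to each facet is flat. -/
structure IsFlatBoundaryMeasure (P : Set E) (σ : Measure E) : Prop where
  carried : σ (frontier P)ᶜ = 0
  flat : ∀ Q : Set E, IsFacet P Q → RestrictsToFlat Q σ

/-- A system `(P, dμ, dσ)`: a simple polytope with a flat measure on it and a flat measure on its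
boundary. -/
structure IsSystem (P : Set E) (μ σ : Measure E) : Prop where
  polytope : IsPolytope P
  simple : IsSimple P
  flat : IsFlatMeasure P μ
  flat_boundary : IsFlatBoundaryMeasure P σ

/-- The distance `|a - b|` of extended non-negative numbers. -/
def absDiff (a b : ℝ≥0∞) : ℝ≥0∞ := (a - b) + (b - a)

/-- Convergence `f i → g` in `L^p(μ)` of `[0, ∞]`-valued functions, for `0 ≤ p ≤ ∞`.
For `p ≠ 0`: all functions lie in `L^p(μ)` and the `L^p` (quasi-)norm of `|f i - g|` tends to zero.
For `p = 0`: all functions are measurable and finite almost everywhere, and `f i → g` in measure. -/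
def TendstoInLp (μ : Measure E) (p : ℝ≥0∞) (f : ℕ → E → ℝ≥0∞) (g : E → ℝ≥0∞) : Prop :=
  (p ≠ 0 → (∀ i, MemLp (f i) p μ) ∧ MemLp g p μ ∧
    Tendsto (fun i => eLpNorm (fun x => absDiff (f i x) (g x)) p μ) atTop (𝓝 0)) ∧
  (p = 0 → (∀ i, AEMeasurable (f i) μ ∧ ∀ᵐ x ∂μ, f i x ≠ ∞) ∧
    (AEMeasurable g μ ∧ ∀ᵐ x ∂μ, g x ≠ ∞) ∧
    ∀ ε : ℝ≥0∞, 0 < ε → Tendsto (fun i => μ {x | ε ≤ absDiff (f i x) (g x)}) atTop (𝓝 0))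

/-- A convex function `P → [0, ∞]`; the values of `u` outside `P` play no role. -/
def IsConvexFun (P : Set E) (u : E → ℝ≥0∞) : Prop :=
  ∀ x ∈ P, ∀ y ∈ P, ∀ s t : ℝ, 0 ≤ s → 0 ≤ t → s + t = 1 →
    u (s • x + t • y) ≤ ENNReal.ofReal s * u x + ENNReal.ofReal t * u y

end FlatPolytope

/-!
Write `∂P` for the boundary of the polytope and `p = n / (n - 1)` for the critical exponent.

*The critical exponent.* On a chord of `P` a convex function is at most the maximum of its two
boundary values. Hence, for every coordinate direction `i`, a convex `u` is bounded by a function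
`G i` (`chordSum`) that does not depend on the `i`-th coordinate, and Fubini's theorem
(`exists_setLIntegral_slide_le`) bounds the integral of `G i` by that of `u` over `∂P`. Since
`u ^ p ≤ ∏ i, G i ^ (1 / (n - 1))`, the grid-lines lemma behind the Gagliardo-Nirenberg inequality
gives `∫ u ^ p ≤ K (∫_{∂P} u) ^ p` (`exists_lintegral_rpow_le`).

*The envelope.* The function `U` of part (a) is the supremum of all lower semicontinuous convex `u`
with `∫_{∂P} u ≤ 1` (`boundaryEnvelope`); the inequality of part (a) then holds by scaling, and what
has to be shown is that `U` is integrable. If `τ < u x`, the closed convex set `u ≤ τ` is separated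
from `x` by a half space, on whose cap of the boundary `u > τ`; so `τ` is at most the inverse of the
measure of the cap. If a box with side lengths `a i` around `x` lies in `P`, every such cap has
measure at least a constant times `(∏ i, a i) / a m`, for each `m`
(`exists_prod_le_mul_measure_cap`), because half of the box can be moved to the boundary in the
direction `m` without leaving the half space. The product over all `m` gives
`U x ≤ K ∏ i, a i ^ (-1 / p)`. By Carathéodory's theorem almost every point of `P` lies in the
interior of a simplex spanned by vertices; the barycentric coordinates other than the largest one
are then admissible side lengths up to the factor `n`, and products of the powers `t ^ (-q / p)`
with `q < p` are integrable (`lintegral_boundaryEnvelope_rpow_lt_top`).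

*Compactness.* By part (a), applied to lower semicontinuous hulls, a bounded sequence of convex
functions is bounded by a multiple of `U`, hence locally bounded and locally equi-Lipschitz on the
interior, and a diagonal sequence converges locally uniformly there
(`exists_subseq_tendsto_interior`). Convergence in `L^q` follows by dominated convergence, and the
bound at the critical exponent for the limit by Fatou's lemma. A lower semicontinuous convex
function is determined by its values on the interior, by passing to the limit along segments
(`le_of_le_on_interior`), which makes the limit unique.
-/

namespace FlatPolytope

variable {E : Type*} [NormedAddCommGroup E]

/-! ### Lower semicontinuous functions -/

/-- The lower semicontinuous hull on `P` of a function `u`: its lower limit along `P`. -/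
noncomputable def lscHull (P : Set E) (u : E → ℝ≥0∞) (x : E) : ℝ≥0∞ := liminf u (𝓝[P] x)

theorem lscHull_le {P : Set E} (u : E → ℝ≥0∞) {x : E} (hx : x ∈ P) : lscHull P u x ≤ u x := by
  refine (liminf_le_liminf_of_le (pure_le_nhdsWithin hx)).trans ?_
  simp [liminf_eq]

theorem lowerSemicontinuousOn_lscHull (P : Set E) (u : E → ℝ≥0∞) :
    LowerSemicontinuousOn (lscHull P u) P := by
  intro x _ y hy
  obtain ⟨z, hyz, hz⟩ := exists_between hy
  have h := eventually_lt_of_lt_liminf hz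
  rw [← eventually_eventually_nhdsWithin] at h
  filter_upwards [h] with x' hx'
  exact hyz.trans_le (le_liminf_of_le (by isBoundedDefault) (hx'.mono fun _ h => h.le))

theorem measurable_indicator_of_lowerSemicontinuousOn [MeasurableSpace E] [BorelSpace E]
    {P F : Set E} {u : E → ℝ≥0∞} (hu : LowerSemicontinuousOn u P) (hF : IsClosed F) (hFP : F ⊆ P) :
    Measurable (F.indicator u) := by
  refine measurable_of_Ioi fun c => ?_
  obtain ⟨O, hO, h⟩ := lowerSemicontinuousOn_iff_preimage_Ioi.1 (hu.mono hFP) c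
  have : F.indicator u ⁻¹' Set.Ioi c = F ∩ O := by
    rw [← h]
    ext x
    by_cases hx : x ∈ F <;> simp [hx]
  rw [this]
  exact hF.measurableSet.inter hO.measurableSet

theorem aemeasurable_of_lowerSemicontinuousOn [MeasurableSpace E] [BorelSpace E]
    {P : Set E} (hP : IsClosed P) {u : E → ℝ≥0∞} (hu : LowerSemicontinuousOn u P)
    (ν : Measure E) : AEMeasurable u (ν.restrict P) :=
  (aemeasurable_indicator_iff hP.measurableSet).1
    (measurable_indicator_of_lowerSemicontinuousOn hu hP subset_rfl).aemeasurable

/-! ### Convergence of extended non-negative functions -/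

theorem absDiff_le_max (a b : ℝ≥0∞) : absDiff a b ≤ max a b := by
  rcases le_total a b with h | h
  · rw [absDiff, tsub_eq_zero_of_le h, zero_add]
    exact tsub_le_self.trans (le_max_right _ _)
  · rw [absDiff, tsub_eq_zero_of_le h, add_zero]
    exact tsub_le_self.trans (le_max_left _ _)

theorem absDiff_triangle_left (a b c : ℝ≥0∞) : absDiff b c ≤ absDiff a b + absDiff a c := by
  unfold absDiff
  calc b - c + (c - b) ≤ ((b - a) + (a - c)) + ((c - a) + (a - b)) :=
        add_le_add (tsub_le_tsub_add_tsub) (tsub_le_tsub_add_tsub)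
    _ = _ := by ring

theorem eq_of_absDiff_eq_zero {a b : ℝ≥0∞} (h : absDiff a b = 0) : a = b := by
  rw [absDiff, add_eq_zero, tsub_eq_zero_iff_le, tsub_eq_zero_iff_le] at h
  exact le_antisymm h.1 h.2

theorem tendsto_absDiff {f : ℕ → ℝ≥0∞} {a : ℝ≥0∞} (ha : a ≠ ∞) (h : Tendsto f atTop (𝓝 a)) :
    Tendsto (fun i => absDiff (f i) a) atTop (𝓝 0) := by
  have h1 := ENNReal.Tendsto.sub h (tendsto_const_nhds (x := a)) (Or.inr ha)
  have h2 := ENNReal.Tendsto.sub (tendsto_const_nhds (x := a)) h (Or.inl ha)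
  simpa [absDiff] using h1.add h2

theorem aemeasurable_absDiff {α : Type*} [MeasurableSpace α] {μ : Measure α} {f g : α → ℝ≥0∞}
    (hf : AEMeasurable f μ) (hg : AEMeasurable g μ) :
    AEMeasurable (fun x => absDiff (f x) (g x)) μ :=
  (hf.sub hg).add (hg.sub hf)

section

variable [MeasurableSpace E]

theorem TendstoInLp.tendsto_measure [BorelSpace E] {μ : Measure E} {p : ℝ≥0∞}
    (hp : p ≠ ∞) {f : ℕ → E → ℝ≥0∞} {g : E → ℝ≥0∞} (h : TendstoInLp μ p f g) {ε : ℝ≥0∞} (hε : 0 < ε) :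
    Tendsto (fun i => μ {x | ε ≤ absDiff (f i x) (g x)}) atTop (𝓝 0) := by
  rcases eq_or_ne p 0 with h0 | h0
  · exact (h.2 h0).2.2 ε hε
  obtain ⟨hf, hg, hlim⟩ := h.1 h0
  have hp0 : 0 < p.toReal := ENNReal.toReal_pos h0 hp
  set δ := min ε 1
  have hδ : δ ≠ 0 := (lt_min hε one_pos).ne'
  have hδtop : δ ≠ ∞ := ne_top_of_le_ne_top ENNReal.one_ne_top (min_le_right _ _)
  have hbd : ∀ i, μ {x | ε ≤ absDiff (f i x) (g x)}
      ≤ δ⁻¹ ^ p.toReal * eLpNorm (fun x => absDiff (f i x) (g x)) p μ ^ p.toReal := by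
    intro i
    have hm : AEStronglyMeasurable (fun x => absDiff (f i x) (g x)) μ :=
      (aemeasurable_absDiff (hf i).aestronglyMeasurable.aemeasurable
        hg.aestronglyMeasurable.aemeasurable).aestronglyMeasurable
    refine le_trans (measure_mono fun x hx => ?_) (meas_ge_le_mul_pow_eLpNorm_enorm μ h0 hp hm hδ
      fun h => absurd h hδtop)
    have hx' : ε ≤ absDiff (f i x) (g x) := hx
    rw [Set.mem_ofPred_eq, enorm_eq_self]
    exact (min_le_left ε 1).trans hx'
  have hlim' : Tendsto (fun i => δ⁻¹ ^ p.toReal *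
      eLpNorm (fun x => absDiff (f i x) (g x)) p μ ^ p.toReal) atTop (𝓝 0) := by
    have h1 := (ENNReal.continuous_rpow_const (y := p.toReal)).continuousAt.tendsto.comp hlim
    rw [ENNReal.zero_rpow_of_pos hp0] at h1
    have h2 := ENNReal.Tendsto.const_mul (a := δ⁻¹ ^ p.toReal) h1
      (Or.inr (ENNReal.rpow_ne_top_of_nonneg hp0.le (ENNReal.inv_ne_top.2 hδ)))
    simpa using h2
  exact tendsto_of_tendsto_of_tendsto_of_le_of_le tendsto_const_nhds hlim' (fun _ => zero_le) hbd

/-- Limits in `L^p` are unique almost everywhere, even when the exponents differ. -/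
theorem TendstoInLp.ae_eq [BorelSpace E] {μ : Measure E} {p q : ℝ≥0∞} (hp : p ≠ ∞) (hq : q ≠ ∞)
    {f : ℕ → E → ℝ≥0∞} {g g' : E → ℝ≥0∞} (h : TendstoInLp μ p f g) (h' : TendstoInLp μ q f g') :
    g =ᵐ[μ] g' := by
  have hnull : ∀ k : ℕ, ∀ᵐ x ∂μ, absDiff (g x) (g' x) < ((k : ℝ≥0∞) + 1)⁻¹ := by
    intro k
    set ε : ℝ≥0∞ := ((k : ℝ≥0∞) + 1)⁻¹
    have hε : 0 < ε := ENNReal.inv_pos.2 (by simp)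
    have hle : ∀ i, μ {x | ε ≤ absDiff (g x) (g' x)}
        ≤ μ {x | ε / 2 ≤ absDiff (f i x) (g x)} + μ {x | ε / 2 ≤ absDiff (f i x) (g' x)} := by
      intro i
      refine (measure_mono fun x hx => ?_).trans (measure_union_le _ _)
      by_contra hnot
      simp only [Set.mem_union, Set.mem_ofPred_eq, not_or, not_le] at hnot
      have := (absDiff_triangle_left (f i x) (g x) (g' x)).trans_lt
        (ENNReal.add_lt_add hnot.1 hnot.2)
      rw [ENNReal.add_halves] at this
      exact absurd hx (not_le.2 this)
    have hlim := (h.tendsto_measure hp (ENNReal.half_pos hε.ne')).add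
      (h'.tendsto_measure hq (ENNReal.half_pos hε.ne'))
    rw [add_zero] at hlim
    have h0 : μ {x | ε ≤ absDiff (g x) (g' x)} = 0 :=
      le_antisymm (ge_of_tendsto' hlim hle) zero_le
    filter_upwards [measure_eq_zero_iff_ae_notMem.1 h0] with x hx
    exact not_le.1 hx
  filter_upwards [ae_all_iff.2 hnull] with x hx
  refine eq_of_absDiff_eq_zero (nonpos_iff_eq_zero.1 (le_of_forall_gt fun c hc => ?_))
  obtain ⟨k, hk⟩ := ENNReal.exists_inv_nat_lt hc.ne'
  refine (hx k).trans (lt_of_le_of_lt (ENNReal.inv_le_inv.2 ?_) hk)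
  exact le_self_add

/-- Dominated convergence in all spaces `L^p`, `p < ∞`. -/
theorem tendstoInLp_of_dominated [BorelSpace E] {μ : Measure E} [IsFiniteMeasure μ]
    {f : ℕ → E → ℝ≥0∞} {g M : E → ℝ≥0∞}
    (hf : ∀ i, AEMeasurable (f i) μ) (hg : AEMeasurable g μ) (hM : ∀ᵐ x ∂μ, M x ≠ ∞)
    (hfM : ∀ i, ∀ᵐ x ∂μ, f i x ≤ M x) (hgM : ∀ᵐ x ∂μ, g x ≤ M x)
    (hlim : ∀ᵐ x ∂μ, Tendsto (fun i => f i x) atTop (𝓝 (g x))) {p : ℝ≥0∞} (hp : p ≠ ∞)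
    (hMp : ∫⁻ x, M x ^ p.toReal ∂μ < ∞) : TendstoInLp μ p f g := by
  have hmem : ∀ v : E → ℝ≥0∞, p ≠ 0 → AEMeasurable v μ → (∀ᵐ x ∂μ, v x ≤ M x) → MemLp v p μ := by
    intro v h0 hv hvM
    refine ⟨hv.aestronglyMeasurable,
      (eLpNorm_lt_top_iff_lintegral_rpow_enorm_lt_top h0 hp).2 (lt_of_le_of_lt ?_ hMp)⟩
    refine lintegral_mono_ae (hvM.mono fun x hx => ?_)
    rw [enorm_eq_self]
    exact ENNReal.rpow_le_rpow hx ENNReal.toReal_nonneg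
  have hdiff : ∀ i, AEMeasurable (fun x => absDiff (f i x) (g x)) μ := fun i =>
    aemeasurable_absDiff (hf i) hg
  have hlim0 : ∀ᵐ x ∂μ, Tendsto (fun i => absDiff (f i x) (g x)) atTop (𝓝 0) := by
    filter_upwards [hM, hgM, hlim] with x h1 h2 h3
    exact tendsto_absDiff (ne_top_of_le_ne_top h1 h2) h3
  refine ⟨fun h0 => ⟨fun i => hmem _ h0 (hf i) (hfM i), hmem _ h0 hg hgM, ?_⟩,
    fun _ => ⟨fun i => ⟨hf i, ?_⟩, ⟨hg, ?_⟩, fun ε hε => ?_⟩⟩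
  · have hp0 : 0 < p.toReal := ENNReal.toReal_pos h0 hp
    have hI : Tendsto (fun i => ∫⁻ x, absDiff (f i x) (g x) ^ p.toReal ∂μ) atTop (𝓝 0) := by
      have := tendsto_lintegral_of_dominated_convergence' (μ := μ)
        (F := fun i x => absDiff (f i x) (g x) ^ p.toReal) (f := fun _ => 0)
        (fun x => M x ^ p.toReal) (fun i => (hdiff i).pow_const _) (fun i => ?_) hMp.ne ?_
      · simpa using this
      · filter_upwards [hfM i, hgM] with x h1 h2
        exact ENNReal.rpow_le_rpow ((absDiff_le_max _ _).trans (max_le h1 h2)) hp0.le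
      · filter_upwards [hlim0] with x hx
        have := (ENNReal.continuous_rpow_const (y := p.toReal)).continuousAt.tendsto.comp hx
        rwa [ENNReal.zero_rpow_of_pos hp0] at this
    have h2 := (ENNReal.continuous_rpow_const (y := 1 / p.toReal)).continuousAt.tendsto.comp hI
    rw [ENNReal.zero_rpow_of_pos (by positivity)] at h2
    refine h2.congr fun i => ?_
    rw [eLpNorm_eq_lintegral_rpow_enorm_toReal h0 hp]
    simp only [enorm_eq_self, Function.comp]
  · filter_upwards [hM, hfM i] with x h1 h2 using ne_top_of_le_ne_top h1 h2
  · filter_upwards [hM, hgM] with x h1 h2 using ne_top_of_le_ne_top h1 h2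
  · have hnull : ∀ i, NullMeasurableSet {x | ε ≤ absDiff (f i x) (g x)} μ := fun i =>
      nullMeasurableSet_le aemeasurable_const (hdiff i)
    have := tendsto_lintegral_of_dominated_convergence' (μ := μ)
      (F := fun i => {x | ε ≤ absDiff (f i x) (g x)}.indicator fun _ => 1) (f := fun _ => 0)
      (fun _ => 1) (fun i => aemeasurable_const.indicator₀ (hnull i))
      (fun i => Eventually.of_forall fun x => Set.indicator_le_self' (fun _ _ => zero_le) x)
      (by simp) ?_
    · simpa [lintegral_indicator_const₀ (hnull _)] using this
    · filter_upwards [hlim0] with x hx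
      refine tendsto_const_nhds.congr' ?_
      filter_upwards [hx.eventually (gt_mem_nhds hε)] with i hi
      rw [Set.indicator_of_notMem]
      exact not_le.2 hi

end

/-! ### Convex functions with values in `[0, ∞]` -/

variable [NormedSpace ℝ E]

theorem IsConvexFun.iSup {ι : Sort*} {P : Set E} {u : ι → E → ℝ≥0∞}
    (hu : ∀ i, IsConvexFun P (u i)) : IsConvexFun P (fun x => ⨆ i, u i x) := by
  intro x hx y hy s t hs ht hst
  refine iSup_le fun i => (hu i x hx y hy s t hs ht hst).trans ?_
  gcongr
  · exact le_iSup (fun i => u i x) i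
  · exact le_iSup (fun i => u i y) i

theorem IsConvexFun.const_mul {P : Set E} {u : E → ℝ≥0∞} (hu : IsConvexFun P u) (c : ℝ≥0∞) :
    IsConvexFun P (fun x => c * u x) := by
  intro x hx y hy s t hs ht hst
  calc c * u (s • x + t • y) ≤ c * (ENNReal.ofReal s * u x + ENNReal.ofReal t * u y) := by
        gcongr; exact hu x hx y hy s t hs ht hst
    _ = _ := by ring

theorem isConvexFun_const (P : Set E) (c : ℝ≥0∞) : IsConvexFun P (fun _ => c) := by
  intro x _ y _ s t hs ht hst
  rw [← add_mul, ← ENNReal.ofReal_add hs ht, hst, ENNReal.ofReal_one, one_mul]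

theorem _root_.ENNReal.limsup_add_le_atTop (f g : ℕ → ℝ≥0∞) :
    Filter.limsup (fun i => f i + g i) atTop
      ≤ Filter.limsup f atTop + Filter.limsup g atTop := by
  simp only [limsup_eq_iInf_iSup_of_nat]
  rw [ENNReal.iInf_add_iInf]
  · refine iInf_mono fun n => iSup₂_le fun i hi => ?_
    gcongr
    · exact le_iSup₂ (f := fun i (_ : i ≥ n) => f i) i hi
    · exact le_iSup₂ (f := fun i (_ : i ≥ n) => g i) i hi
  · intro i j
    refine ⟨max i j, ?_⟩
    exact add_le_add (biSup_mono fun k hk => (le_max_left i j).trans hk)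
      (biSup_mono fun k hk => (le_max_right i j).trans hk)

theorem IsConvexFun.limsup {P : Set E} {u : ℕ → E → ℝ≥0∞} (hu : ∀ i, IsConvexFun P (u i)) :
    IsConvexFun P (fun x => Filter.limsup (fun i => u i x) atTop) := by
  intro x hx y hy s t hs ht hst
  calc Filter.limsup (fun i => u i (s • x + t • y)) atTop
      ≤ Filter.limsup (fun i => ENNReal.ofReal s * u i x + ENNReal.ofReal t * u i y) atTop :=
        limsup_le_limsup (Eventually.of_forall fun i => hu i x hx y hy s t hs ht hst)
    _ ≤ Filter.limsup (fun i => ENNReal.ofReal s * u i x) atTop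
        + Filter.limsup (fun i => ENNReal.ofReal t * u i y) atTop := ENNReal.limsup_add_le_atTop _ _
    _ = _ := by
        rw [ENNReal.limsup_const_mul_of_ne_top ENNReal.ofReal_ne_top,
          ENNReal.limsup_const_mul_of_ne_top ENNReal.ofReal_ne_top]

theorem IsConvexFun.convex_setOf_le {P : Set E} (hP : Convex ℝ P) {u : E → ℝ≥0∞}
    (hu : IsConvexFun P u) (c : ℝ≥0∞) : Convex ℝ {x ∈ P | u x ≤ c} := by
  intro x hx y hy s t hs ht hst
  refine ⟨hP hx.1 hy.1 hs ht hst, (hu x hx.1 y hy.1 s t hs ht hst).trans ?_⟩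
  calc _ ≤ ENNReal.ofReal s * c + ENNReal.ofReal t * c := by gcongr; exacts [hx.2, hy.2]
    _ = c := by rw [← add_mul, ← ENNReal.ofReal_add hs ht, hst, ENNReal.ofReal_one, one_mul]

theorem IsConvexFun.convex_setOf_ne_top {P : Set E} (hP : Convex ℝ P) {u : E → ℝ≥0∞}
    (hu : IsConvexFun P u) : Convex ℝ {x ∈ P | u x ≠ ∞} := by
  intro x hx y hy s t hs ht hst
  refine ⟨hP hx.1 hy.1 hs ht hst, ne_top_of_le_ne_top ?_ (hu x hx.1 y hy.1 s t hs ht hst)⟩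
  exact ENNReal.add_ne_top.2 ⟨ENNReal.mul_ne_top ENNReal.ofReal_ne_top hx.2,
    ENNReal.mul_ne_top ENNReal.ofReal_ne_top hy.2⟩

theorem IsConvexFun.le_max_of_mem_segment {P : Set E} {u : E → ℝ≥0∞} (hu : IsConvexFun P u)
    {x y z : E} (hx : x ∈ P) (hy : y ∈ P) (hz : z ∈ segment ℝ x y) : u z ≤ max (u x) (u y) := by
  obtain ⟨s, t, hs, ht, hst, rfl⟩ := hz
  refine (hu x hx y hy s t hs ht hst).trans ?_
  calc _ ≤ ENNReal.ofReal s * max (u x) (u y) + ENNReal.ofReal t * max (u x) (u y) := by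
        gcongr
        · exact le_max_left _ _
        · exact le_max_right _ _
    _ = _ := by rw [← add_mul, ← ENNReal.ofReal_add hs ht, hst, ENNReal.ofReal_one, one_mul]

/-- Convex functions that are finite on the interior are real-valued convex functions there. -/
theorem IsConvexFun.convexOn_toReal {P : Set E} (hP : Convex ℝ P) {u : E → ℝ≥0∞}
    (hu : IsConvexFun P u) (hfin : ∀ x ∈ interior P, u x ≠ ∞) :
    ConvexOn ℝ (interior P) (fun x => (u x).toReal) := by
  refine ⟨hP.interior, fun x hx y hy s t hs ht hst => ?_⟩
  have hx' := hfin x hx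
  have hy' := hfin y hy
  have h := hu x (interior_subset hx) y (interior_subset hy) s t hs ht hst
  have hr : ENNReal.ofReal s * u x + ENNReal.ofReal t * u y ≠ ∞ :=
    ENNReal.add_ne_top.2 ⟨ENNReal.mul_ne_top ENNReal.ofReal_ne_top hx',
      ENNReal.mul_ne_top ENNReal.ofReal_ne_top hy'⟩
  have := ENNReal.toReal_mono hr h
  rwa [ENNReal.toReal_add (ENNReal.mul_ne_top ENNReal.ofReal_ne_top hx')
    (ENNReal.mul_ne_top ENNReal.ofReal_ne_top hy'), ENNReal.toReal_mul, ENNReal.toReal_mul,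
    ENNReal.toReal_ofReal hs, ENNReal.toReal_ofReal ht] at this

theorem IsConvexFun.continuousAt [FiniteDimensional ℝ E] {P : Set E} (hP : Convex ℝ P)
    {u : E → ℝ≥0∞} (hu : IsConvexFun P u) (hfin : ∀ x ∈ interior P, u x ≠ ∞) {x : E}
    (hx : x ∈ interior P) : ContinuousAt u x := by
  have hc : ContinuousAt (fun x => (u x).toReal) x :=
    ((hu.convexOn_toReal hP hfin).continuousOn isOpen_interior).continuousAt
      (isOpen_interior.mem_nhds hx)
  have h2 : ContinuousAt (fun x => ENNReal.ofReal (u x).toReal) x :=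
    ENNReal.continuous_ofReal.continuousAt.comp hc
  refine h2.congr ?_
  filter_upwards [isOpen_interior.mem_nhds hx] with y hy
  exact ENNReal.ofReal_toReal (hfin y hy)

/-- A convex set that is dense in an open set contains it. -/
theorem _root_.Convex.subset_of_isOpen_of_subset_closure [FiniteDimensional ℝ E] {D O : Set E}
    (hD : Convex ℝ D) (hO : IsOpen O) (h : O ⊆ closure D) : O ⊆ D := by
  rcases O.eq_empty_or_nonempty with rfl | hne
  · exact Set.empty_subset _
  have hint : (interior D).Nonempty := by
    rw [hD.interior_nonempty_iff_affineSpan_eq_top]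
    have hcl : IsClosed (affineSpan ℝ D : Set E) := (affineSpan ℝ D).closed_of_finiteDimensional
    have h1 : O ⊆ (affineSpan ℝ D : Set E) :=
      h.trans (closure_minimal (subset_affineSpan ℝ D) hcl)
    have h2 : affineSpan ℝ O ≤ affineSpan ℝ D := affineSpan_le.2 h1
    rw [hO.affineSpan_eq_top hne] at h2
    exact top_le_iff.1 h2
  have := interior_maximal h hO
  rw [hD.interior_closure_eq_interior_of_nonempty_interior hint] at this
  exact this.trans interior_subset

theorem IsConvexFun.lscHull {P : Set E} (hP : Convex ℝ P) {u : E → ℝ≥0∞} (hu : IsConvexFun P u) :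
    IsConvexFun P (lscHull P u) := by
  intro x hx y hy s t hs ht hst
  rcases hs.eq_or_lt with rfl | hs
  · obtain rfl : t = 1 := by linarith
    simp
  rcases ht.eq_or_lt with rfl | ht
  · obtain rfl : s = 1 := by linarith
    simp
  refine le_of_forall_lt fun c' hc' => ?_
  obtain ⟨c, hcc, hc⟩ := exists_between hc'
  have hev := eventually_lt_of_lt_liminf hc
  have htend : Tendsto (fun p : E × E => s • p.1 + t • p.2) (𝓝[P] x ×ˢ 𝓝[P] y)
      (𝓝[P] (s • x + t • y)) := by
    refine tendsto_nhdsWithin_iff.2 ⟨?_, ?_⟩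
    · have : Tendsto (fun p : E × E => s • p.1 + t • p.2) (𝓝 (x, y)) (𝓝 (s • x + t • y)) := by
        have h : Continuous (fun p : E × E => s • p.1 + t • p.2) := by fun_prop
        exact h.tendsto (x, y)
      refine this.mono_left ?_
      rw [nhds_prod_eq]
      exact Filter.prod_mono nhdsWithin_le_nhds nhdsWithin_le_nhds
    · exact (eventually_mem_nhdsWithin.prod_mk eventually_mem_nhdsWithin).mono
        fun p hp => hP hp.1 hp.2 hs.le ht.le hst
  have h2 := (htend.eventually hev).and
    ((eventually_mem_nhdsWithin (a := x) (s := P)).prod_mk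
      (eventually_mem_nhdsWithin (a := y) (s := P)))
  obtain ⟨pa, ha, pb, hb, hab⟩ := eventually_prod_iff.1 h2
  have key : c ≤ ENNReal.ofReal s * (⨅ a : {a // pa a}, u a)
      + ENNReal.ofReal t * (⨅ b : {b // pb b}, u b) := by
    have hs0 : ENNReal.ofReal s ≠ 0 := by simpa using hs
    have ht0 : ENNReal.ofReal t ≠ 0 := by simpa using ht
    rw [ENNReal.mul_iInf_of_ne hs0 ENNReal.ofReal_ne_top,
      ENNReal.mul_iInf_of_ne ht0 ENNReal.ofReal_ne_top]
    refine ENNReal.le_iInf_add_iInf fun a b => ?_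
    obtain ⟨h1, h2, h3⟩ := hab a.2 b.2
    exact h1.le.trans (hu _ h2 _ h3 s t hs.le ht.le hst)
  refine hcc.trans_le (key.trans ?_)
  gcongr
  · exact le_liminf_of_le (by isBoundedDefault)
      (ha.mono fun a h => iInf_le (fun a : {a // pa a} => u a) ⟨a, h⟩)
  · exact le_liminf_of_le (by isBoundedDefault)
      (hb.mono fun a h => iInf_le (fun a : {a // pb a} => u a) ⟨a, h⟩)

theorem IsConvexFun.lscHull_eq [FiniteDimensional ℝ E] {P : Set E} (hP : Convex ℝ P)
    {u : E → ℝ≥0∞} (hu : IsConvexFun P u) (hfin : ∀ x ∈ interior P, u x ≠ ∞) {x : E}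
    (hx : x ∈ interior P) : FlatPolytope.lscHull P u x = u x := by
  have : 𝓝[P] x = 𝓝 x := nhdsWithin_eq_nhds.2 (mem_interior_iff_mem_nhds.1 hx)
  rw [FlatPolytope.lscHull, this]
  exact (hu.continuousAt hP hfin hx).tendsto.liminf_eq

/-- If the lower semicontinuous hull of a convex function is finite on the interior, so is the
function itself: it is finite on a dense convex subset. -/
theorem IsConvexFun.ne_top_of_lscHull_ne_top [FiniteDimensional ℝ E] {P : Set E}
    (hP : Convex ℝ P) {u : E → ℝ≥0∞} (hu : IsConvexFun P u)
    (hfin : ∀ x ∈ interior P, FlatPolytope.lscHull P u x ≠ ∞) : ∀ x ∈ interior P, u x ≠ ∞ := by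
  suffices interior P ⊆ {x ∈ P | u x ≠ ∞} from fun x hx => (this hx).2
  refine (hu.convex_setOf_ne_top hP).subset_of_isOpen_of_subset_closure isOpen_interior ?_
  intro x hx
  rw [mem_closure_iff_frequently]
  have h : ∃ᶠ y in 𝓝[P] x, u y < ∞ :=
    frequently_lt_of_liminf_lt (by isBoundedDefault) (lt_top_iff_ne_top.2 (hfin x hx))
  exact ((h.and_eventually eventually_mem_nhdsWithin).mono fun y hy => ⟨hy.2, hy.1.ne⟩).filter_mono
    nhdsWithin_le_nhds

/-- An inequality `v ≤ w` between a lower semicontinuous function and a convex function spreads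
from the interior to the boundary, along segments into the interior. -/
theorem le_of_le_on_interior {P : Set E} (hP : Convex ℝ P) {v w : E → ℝ≥0∞}
    (hv : LowerSemicontinuousOn v P) (hw : IsConvexFun P w) {p : E} (hp : p ∈ interior P)
    (hwp : w p ≠ ∞) (h : ∀ x ∈ interior P, v x ≤ w x) : ∀ x ∈ P, v x ≤ w x := by
  intro x hx
  by_contra! hlt
  obtain ⟨c, hc1, hc2⟩ := exists_between hlt
  have hev := hv x hx c hc2
  have hwx : w x ≠ ∞ := (hc1.trans_le le_top).ne
  have hmem : ∀ t : ℝ, 0 < t → t < 1 → (1 - t) • x + t • p ∈ interior P := fun t h0 h1 =>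
    hP.combo_self_interior_mem_interior hx hp (by linarith) h0 (by ring)
  have hIoo : Set.Ioo (0 : ℝ) 1 ∈ 𝓝[>] (0 : ℝ) := Ioo_mem_nhdsGT one_pos
  have ht : Tendsto (fun t : ℝ => (1 - t) • x + t • p) (𝓝[>] 0) (𝓝[P] x) := by
    refine tendsto_nhdsWithin_iff.2 ⟨?_, ?_⟩
    · have h : Continuous (fun t : ℝ => (1 - t) • x + t • p) := by fun_prop
      have := h.tendsto 0
      simp only [sub_zero, one_smul, zero_smul, add_zero] at this
      exact this.mono_left nhdsWithin_le_nhds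
    · filter_upwards [hIoo] with t ht
      exact interior_subset (hmem t ht.1 ht.2)
  have ht2 : Tendsto (fun t : ℝ => ENNReal.ofReal (1 - t) * w x + ENNReal.ofReal t * w p)
      (𝓝[>] 0) (𝓝 (w x)) := by
    have h1 : Tendsto (fun t : ℝ => ENNReal.ofReal (1 - t)) (𝓝 0) (𝓝 1) := by
      have h : Continuous (fun t : ℝ => ENNReal.ofReal (1 - t)) :=
        ENNReal.continuous_ofReal.comp (by fun_prop)
      simpa using h.tendsto 0
    have h2 : Tendsto (fun t : ℝ => ENNReal.ofReal t) (𝓝 0) (𝓝 0) := by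
      simpa using ENNReal.continuous_ofReal.tendsto 0
    have := (ENNReal.Tendsto.mul_const h1 (Or.inr hwx)).add
      (ENNReal.Tendsto.mul_const h2 (Or.inr hwp))
    simp only [one_mul, zero_mul, add_zero] at this
    exact this.mono_left nhdsWithin_le_nhds
  obtain ⟨t, hta, htb, htc⟩ :=
    ((ht.eventually hev).and ((ht2.eventually (gt_mem_nhds hc1)).and hIoo)).exists
  have h1 := hw x hx p (interior_subset hp) (1 - t) t (by linarith [htc.2]) htc.1.le (by ring)
  exact absurd (hta.trans_le ((h _ (hmem t htc.1 htc.2)).trans h1)) (not_lt.2 htb.le)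

/-! ### Facets, vertices and chords of polytopes -/

theorem affine_apply_add (ℓ : E →ᵃ[ℝ] ℝ) (x v : E) : ℓ (x + v) = ℓ x + ℓ.linear v := by
  have := ℓ.map_vadd x v
  simpa [add_comm] using this

theorem affine_linear_sub (ℓ : E →ᵃ[ℝ] ℝ) (x y : E) : ℓ.linear (y - x) = ℓ y - ℓ x := by
  simpa using ℓ.linearMap_vsub y x

theorem convex_halfSpace (ℓ : E →ᵃ[ℝ] ℝ) : Convex ℝ (halfSpace ℓ) :=
  (convex_Ici (0 : ℝ)).affine_preimage ℓ

theorem IsPolytope.isClosed {P : Set E} (hP : IsPolytope P) : IsClosed P := hP.isCompact.isClosed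

theorem IsPolytope.convex {P : Set E} (hP : IsPolytope P) : Convex ℝ P := by
  obtain ⟨L, -, -, rfl⟩ := hP.exists_halfSpaces
  exact convex_iInter₂ fun ℓ _ => convex_halfSpace ℓ

/-- A non-zero affine function that is non-negative on a set is positive on its interior. -/
theorem pos_of_mem_interior {P : Set E} {ℓ : E →ᵃ[ℝ] ℝ} (hℓ : ℓ ≠ 0) (h : P ⊆ halfSpace ℓ) {p : E}
    (hp : p ∈ interior P) : 0 < ℓ p := by
  refine lt_of_le_of_ne (h (interior_subset hp)) fun h0 => hℓ ?_
  have hlin : ∀ w, 0 ≤ ℓ.linear w := by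
    intro w
    have ht : Tendsto (fun t : ℝ => p + t • w) (𝓝[>] 0) (𝓝 p) := by
      have h : Continuous (fun t : ℝ => p + t • w) := by fun_prop
      have := h.tendsto 0
      simp only [zero_smul, add_zero] at this
      exact this.mono_left nhdsWithin_le_nhds
    obtain ⟨t, ht1, ht2⟩ := ((ht.eventually (mem_interior_iff_mem_nhds.1 hp)).and
      self_mem_nhdsWithin).exists
    have h1 : 0 ≤ ℓ (p + t • w) := h ht1
    rw [affine_apply_add, ← h0, zero_add, map_smul, smul_eq_mul] at h1
    exact nonneg_of_mul_nonneg_right h1 ht2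
  ext y
  have h1 := hlin (y - p)
  have h2 := hlin (p - y)
  rw [affine_linear_sub, ← h0] at h1 h2
  simp only [AffineMap.coe_zero, Pi.zero_apply]
  linarith

/-- A finite family `L` of affine functions that cuts out `P` irredundantly: each `ℓ ∈ L` is
non-constant and cuts out a facet, whose direction is the kernel of the linear part of `ℓ`. -/
structure IsFacetPresentation (P : Set E) (L : Finset (E →ᵃ[ℝ] ℝ)) : Prop where
  eq_iInter : P = ⋂ ℓ ∈ L, halfSpace ℓ
  linear_ne_zero : ∀ ℓ ∈ L, ℓ.linear ≠ 0
  isFacet : ∀ ℓ ∈ L, IsFacet P (P ∩ {x | ℓ x = 0})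
  vectorSpan_eq : ∀ ℓ ∈ L, vectorSpan ℝ (P ∩ {x | ℓ x = 0}) = LinearMap.ker ℓ.linear

theorem IsFacetPresentation.mem_iff {P : Set E} {L : Finset (E →ᵃ[ℝ] ℝ)}
    (hL : IsFacetPresentation P L) {x : E} : x ∈ P ↔ ∀ ℓ ∈ L, 0 ≤ ℓ x := by
  rw [hL.eq_iInter]
  simp [halfSpace]

/-- A smallest family of half spaces that cuts out `P` defines the facets of `P`: when `ℓ` is not
redundant, a segment from an interior point to a point violating only `ℓ` leaves `P` in the
relative interior of the face cut out by `ℓ`. -/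
theorem IsPolytope.exists_isFacetPresentation [FiniteDimensional ℝ E] {P : Set E}
    (hP : IsPolytope P) : ∃ L : Finset (E →ᵃ[ℝ] ℝ), IsFacetPresentation P L := by
  classical
  obtain ⟨p, hp⟩ := hP.nonempty_interior
  obtain ⟨L₀, hfin, hne, hPL⟩ := hP.exists_halfSpaces
  obtain ⟨L, ⟨hLne, hL⟩, hmin⟩ := exists_minimal_of_wellFoundedLT
    (fun T : Finset (E →ᵃ[ℝ] ℝ) => (∀ ℓ ∈ T, ℓ ≠ 0) ∧ P = ⋂ ℓ ∈ T, halfSpace ℓ)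
    ⟨hfin.toFinset, by simpa using hne, by simpa using hPL⟩
  have mem_iff : ∀ x, x ∈ P ↔ ∀ ℓ ∈ L, 0 ≤ ℓ x := by
    intro x; rw [hL]; simp [halfSpace]
  have hsub : ∀ ℓ ∈ L, P ⊆ halfSpace ℓ := fun ℓ hℓ x hx => (mem_iff x).1 hx ℓ hℓ
  have hpos : ∀ ℓ ∈ L, 0 < ℓ p := fun ℓ hℓ => pos_of_mem_interior (hLne ℓ hℓ) (hsub ℓ hℓ) hp
  have key : ∀ ℓ ∈ L, ∃ z, ℓ z = 0 ∧ ∀ ℓ' ∈ L, ℓ' ≠ ℓ → 0 < ℓ' z := by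
    intro ℓ hℓ
    have hnot : ¬ ∀ x, (∀ ℓ' ∈ L.erase ℓ, 0 ≤ ℓ' x) → 0 ≤ ℓ x := by
      intro hall
      have : L ≤ L.erase ℓ := hmin ⟨fun ℓ' h => hLne ℓ' (Finset.mem_of_mem_erase h), by
        ext x
        rw [mem_iff]
        simp only [Set.mem_iInter, halfSpace, Set.mem_ofPred_eq]
        refine ⟨fun h ℓ' h' => h ℓ' (Finset.mem_of_mem_erase h'), fun h ℓ' h' => ?_⟩
        by_cases he : ℓ' = ℓ
        · rw [he]; exact hall x h
        · exact h ℓ' (Finset.mem_erase.2 ⟨he, h'⟩)⟩ (Finset.erase_subset _ _)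
      exact Finset.notMem_erase ℓ L (this hℓ)
    push Not at hnot
    obtain ⟨y, hy, hy0⟩ := hnot
    have hp0 := hpos ℓ hℓ
    have hd : 0 < ℓ p - ℓ y := by linarith
    refine ⟨p + (ℓ p / (ℓ p - ℓ y)) • (y - p), ?_, fun ℓ' hℓ' hne' => ?_⟩
    · rw [affine_apply_add, map_smul, affine_linear_sub, smul_eq_mul]
      field_simp
      ring
    · rw [affine_apply_add, map_smul, affine_linear_sub, smul_eq_mul]
      have h1 := hpos ℓ' hℓ'
      have h2 := hy ℓ' (Finset.mem_erase.2 ⟨hne', hℓ'⟩)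
      have ht : ℓ p / (ℓ p - ℓ y) < 1 := by rw [div_lt_one hd]; linarith
      have ht0 : 0 ≤ ℓ p / (ℓ p - ℓ y) := by positivity
      nlinarith [mul_pos (sub_pos.2 ht) h1, mul_nonneg ht0 h2]
  have hlin : ∀ ℓ ∈ L, ℓ.linear ≠ 0 := by
    intro ℓ hℓ h0
    obtain ⟨z, hz, -⟩ := key ℓ hℓ
    have := affine_linear_sub ℓ z p
    rw [h0, hz] at this
    simp at this
    exact (hpos ℓ hℓ).ne this
  have hspan : ∀ ℓ ∈ L, (P ∩ {x | ℓ x = 0}).Nonempty ∧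
      vectorSpan ℝ (P ∩ {x | ℓ x = 0}) = LinearMap.ker ℓ.linear := by
    intro ℓ hℓ
    obtain ⟨z, hz, hz'⟩ := key ℓ hℓ
    have hzP : z ∈ P := (mem_iff z).2 fun ℓ' hℓ' => by
      by_cases he : ℓ' = ℓ
      · rw [he, hz]
      · exact (hz' ℓ' hℓ' he).le
    refine ⟨⟨z, hzP, hz⟩, le_antisymm ?_ fun w hw => ?_⟩
    · rw [vectorSpan_def, Submodule.span_le]
      rintro _ ⟨a, ha, b, hb, rfl⟩
      have h1 : ℓ a = 0 := ha.2
      have h2 : ℓ b = 0 := hb.2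
      simp [affine_linear_sub, h1, h2]
    · rw [LinearMap.mem_ker] at hw
      have hev : ∀ᶠ t : ℝ in 𝓝[>] 0, ∀ ℓ' ∈ L, 0 ≤ ℓ' (z + t • w) := by
        rw [Filter.eventually_all_finset]
        intro ℓ' hℓ'
        by_cases he : ℓ' = ℓ
        · refine Eventually.of_forall fun t => ?_
          rw [he, affine_apply_add, hz, map_smul, hw]
          simp
        · have hc : Continuous (fun t : ℝ => ℓ' z + t * ℓ'.linear w) := by fun_prop
          have ht := hc.tendsto 0
          simp only [zero_mul, add_zero] at ht
          filter_upwards [nhdsWithin_le_nhds (ht.eventually (lt_mem_nhds (hz' ℓ' hℓ' he)))] with t ht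
          rw [affine_apply_add, map_smul, smul_eq_mul]
          exact ht.le
      obtain ⟨t, ht, ht0⟩ := (hev.and self_mem_nhdsWithin).exists
      have h1 : z + t • w ∈ P ∩ {x | ℓ x = 0} := by
        refine ⟨(mem_iff _).2 ht, ?_⟩
        simp only [Set.mem_ofPred_eq]
        rw [affine_apply_add, hz, map_smul, hw]
        simp
      have h2 := vsub_mem_vectorSpan ℝ h1 (show z ∈ P ∩ {x | ℓ x = 0} from ⟨hzP, hz⟩)
      have ht0' : t ≠ 0 := (Set.mem_Ioi.1 ht0).ne'
      have := Submodule.smul_mem _ t⁻¹ h2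
      simpa [smul_smul, inv_mul_cancel₀ ht0'] using this
  refine ⟨L, hL, hlin, fun ℓ hℓ => ⟨⟨ℓ, hLne ℓ hℓ, hsub ℓ hℓ, rfl⟩, (hspan ℓ hℓ).1, ?_⟩,
    fun ℓ hℓ => (hspan ℓ hℓ).2⟩
  rw [(hspan ℓ hℓ).2]
  have h := LinearMap.finrank_range_add_finrank_ker ℓ.linear
  rw [LinearMap.range_eq_top.2 (LinearMap.surjective (hlin ℓ hℓ)), finrank_top,
    finrank_self] at h
  omega

section Facets

variable {P : Set E} {L : Finset (E →ᵃ[ℝ] ℝ)}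

theorem IsFacetPresentation.facet_subset_frontier (hL : IsFacetPresentation P L)
    {ℓ : E →ᵃ[ℝ] ℝ} (hℓ : ℓ ∈ L) : P ∩ {x | ℓ x = 0} ⊆ frontier P := by
  rintro x ⟨hx, hx0⟩
  refine ⟨subset_closure hx, fun hint => ?_⟩
  have hne : ℓ ≠ 0 := fun h => hL.linear_ne_zero ℓ hℓ (by rw [h]; rfl)
  exact (pos_of_mem_interior hne (fun y hy => hL.mem_iff.1 hy ℓ hℓ) hint).ne' hx0

theorem IsFacetPresentation.frontier_subset [FiniteDimensional ℝ E] (hP : IsClosed P) (hL : IsFacetPresentation P L) :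
    frontier P ⊆ ⋃ ℓ ∈ L, P ∩ {x | ℓ x = 0} := by
  intro x hx
  have hxP : x ∈ P := hP.frontier_subset hx
  by_contra hnot
  simp only [Set.mem_iUnion, not_exists] at hnot
  have hpos : ∀ ℓ ∈ L, 0 < ℓ x := fun ℓ hℓ =>
    lt_of_le_of_ne (hL.mem_iff.1 hxP ℓ hℓ) fun h => hnot ℓ hℓ ⟨hxP, h.symm⟩
  refine hx.2 (mem_interior_iff_mem_nhds.2 ?_)
  have hev : ∀ᶠ y in 𝓝 x, ∀ ℓ ∈ L, 0 ≤ ℓ y := by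
    rw [Filter.eventually_all_finset]
    intro ℓ hℓ
    have hc : Continuous ℓ := ℓ.continuous_of_finiteDimensional
    filter_upwards [(hc.tendsto x).eventually (lt_mem_nhds (hpos ℓ hℓ))] with y hy using hy.le
  filter_upwards [hev] with y hy using hL.mem_iff.2 hy

/-- The projection along the direction `e` to the hyperplane `ℓ = 0`, meaningful when `ℓ` is not
constant along `e`. -/
noncomputable def slide (ℓ : E →ᵃ[ℝ] ℝ) (e x : E) : E := x - (ℓ x / ℓ.linear e) • e

theorem slide_add_smul {ℓ : E →ᵃ[ℝ] ℝ} {e : E} (he : ℓ.linear e ≠ 0) (x : E) (t : ℝ) :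
    slide ℓ e (x + t • e) = slide ℓ e x := by
  rw [slide, slide, affine_apply_add, map_smul, smul_eq_mul, add_div, mul_div_assoc,
    div_self he, mul_one, add_smul]
  abel

theorem continuous_slide [FiniteDimensional ℝ E] (ℓ : E →ᵃ[ℝ] ℝ) (e : E) : Continuous (slide ℓ e) := by
  have hc : Continuous ℓ := ℓ.continuous_of_finiteDimensional
  unfold slide
  fun_prop

/-- The ray from a point of a polytope in a direction `e` leaves the polytope through a facet. -/
theorem IsFacetPresentation.exists_exit (hP : IsCompact P) (hL : IsFacetPresentation P L) {e : E}
    (he : e ≠ 0) {x : E} (hx : x ∈ P) :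
    ∃ ℓ ∈ L, ℓ.linear e ≠ 0 ∧ slide ℓ e x ∈ P ∩ {y | ℓ y = 0} ∧
      ∃ t : ℝ, 0 ≤ t ∧ slide ℓ e x = x + t • e := by
  classical
  have hne : (L.filter fun ℓ => ℓ.linear e < 0).Nonempty := by
    by_contra hempty
    rw [Finset.not_nonempty_iff_eq_empty, Finset.filter_eq_empty_iff] at hempty
    obtain ⟨R, hR⟩ := hP.isBounded.exists_norm_le
    have hray : ∀ t : ℝ, 0 ≤ t → x + t • e ∈ P := fun t ht => hL.mem_iff.2 fun ℓ hℓ => by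
      rw [affine_apply_add, map_smul, smul_eq_mul]
      have h1 := hL.mem_iff.1 hx ℓ hℓ
      have h2 := mul_nonneg ht (not_lt.1 (hempty hℓ))
      linarith
    have hpos : 0 < ‖e‖ := norm_pos_iff.2 he
    have hR0 : 0 ≤ R := (norm_nonneg x).trans (hR x hx)
    have h1 := hR _ (hray ((2 * R + 1) / ‖e‖) (by positivity))
    have h2 : ‖((2 * R + 1) / ‖e‖) • e‖ = 2 * R + 1 := by
      rw [norm_smul, Real.norm_of_nonneg (by positivity), div_mul_cancel₀ _ hpos.ne']
    have h3 := norm_sub_norm_le (((2 * R + 1) / ‖e‖) • e) (-x)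
    rw [sub_neg_eq_add, add_comm _ x, norm_neg, h2] at h3
    linarith [hR x hx]
  obtain ⟨ℓ, hℓ, hmin⟩ := Finset.exists_min_image _ (fun ℓ : E →ᵃ[ℝ] ℝ => ℓ x / -ℓ.linear e) hne
  rw [Finset.mem_filter] at hℓ
  obtain ⟨hℓL, hneg⟩ := hℓ
  have hx0 := hL.mem_iff.1 hx ℓ hℓL
  have heq : slide ℓ e x = x + (ℓ x / -ℓ.linear e) • e := by
    rw [slide, div_neg, neg_smul, sub_eq_add_neg]
  have ht : 0 ≤ ℓ x / -ℓ.linear e := div_nonneg hx0 (by linarith)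
  refine ⟨ℓ, hℓL, hneg.ne, ⟨hL.mem_iff.2 fun ℓ' hℓ' => ?_, ?_⟩, _, ht, heq⟩
  · have h1 := hL.mem_iff.1 hx ℓ' hℓ'
    rw [heq, affine_apply_add, map_smul, smul_eq_mul]
    rcases lt_or_ge (ℓ'.linear e) 0 with h | h
    · have h2 := hmin ℓ' (Finset.mem_filter.2 ⟨hℓ', h⟩)
      rw [le_div_iff₀ (by linarith)] at h2
      linarith
    · have := mul_nonneg ht h
      linarith
  · have := hneg.ne
    rw [Set.mem_ofPred_eq, heq, affine_apply_add, map_smul, smul_eq_mul]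
    field_simp
    ring

/-- An extreme point is determined by the set of half spaces whose boundary contains it. -/
theorem IsFacetPresentation.finite_extremePoints (hL : IsFacetPresentation P L) :
    (P.extremePoints ℝ).Finite := by
  classical
  refine Set.Finite.of_injOn (f := fun x => L.filter fun ℓ => ℓ x = 0)
    (t := (L.powerset : Set (Finset (E →ᵃ[ℝ] ℝ)))) 
    (fun x _ => Finset.mem_coe.2 (Finset.mem_powerset.2 (Finset.filter_subset _ _))) ?_
    (Finset.finite_toSet _)
  intro x hx y hy hxy
  by_contra hne
  have hact : ∀ ℓ ∈ L, ℓ x = 0 → ℓ y = 0 := fun ℓ hℓ h => by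
    have : ℓ ∈ L.filter fun ℓ => ℓ y = 0 := by
      rw [← show (L.filter fun ℓ => ℓ x = 0) = L.filter fun ℓ => ℓ y = 0 from hxy]
      exact Finset.mem_filter.2 ⟨hℓ, h⟩
    exact (Finset.mem_filter.1 this).2
  have hev : ∀ w : E, (∀ ℓ ∈ L, ℓ x = 0 → ℓ.linear w = 0) →
      ∀ᶠ t : ℝ in 𝓝[>] 0, x + t • w ∈ P := by
    intro w hw
    simp only [hL.mem_iff]
    rw [Filter.eventually_all_finset]
    intro ℓ hℓ
    rcases (hL.mem_iff.1 hx.1 ℓ hℓ).eq_or_lt with h0 | h0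
    · refine Eventually.of_forall fun t => ?_
      rw [affine_apply_add, map_smul, hw ℓ hℓ h0.symm, ← h0]
      simp
    · have hc : Continuous (fun t : ℝ => ℓ x + t * ℓ.linear w) := by fun_prop
      have ht := hc.tendsto 0
      simp only [zero_mul, add_zero] at ht
      filter_upwards [nhdsWithin_le_nhds (ht.eventually (lt_mem_nhds h0))] with t ht
      rw [affine_apply_add, map_smul, smul_eq_mul]
      exact ht.le
  have h1 := hev (y - x) fun ℓ hℓ h => by rw [affine_linear_sub, h, hact ℓ hℓ h, sub_zero]
  have h2 := hev (-(y - x)) fun ℓ hℓ h => by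
    rw [map_neg, affine_linear_sub, h, hact ℓ hℓ h, sub_zero, neg_zero]
  obtain ⟨t, ⟨ht1, ht2⟩, ht0⟩ := ((h1.and h2).and self_mem_nhdsWithin).exists
  have hseg : x ∈ openSegment ℝ (x + t • (y - x)) (x + t • -(y - x)) := by
    refine ⟨1 / 2, 1 / 2, by norm_num, by norm_num, by norm_num, ?_⟩
    module
  have := (mem_extremePoints.1 hx).2 _ ht1 _ ht2 hseg
  have h3 : t • (y - x) = 0 := by simpa using this.1
  rcases smul_eq_zero.1 h3 with h | h
  · exact (Set.mem_Ioi.1 ht0).ne' h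
  · exact hne (sub_eq_zero.1 h).symm

theorem IsPolytope.exists_eq_convexHull [FiniteDimensional ℝ E] (hP : IsPolytope P) :
    ∃ S : Finset E, P = convexHull ℝ (S : Set E) := by
  obtain ⟨L, hL⟩ := hP.exists_isFacetPresentation
  refine ⟨hL.finite_extremePoints.toFinset, ?_⟩
  have h := closure_convexHull_extremePoints hP.isCompact hP.convex
  have hcl : IsClosed (convexHull ℝ (P.extremePoints ℝ)) :=
    hL.finite_extremePoints.isClosed_convexHull _
  rw [hcl.closure_eq] at h
  rw [Set.Finite.coe_toFinset, h]

end Facets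

/-! ### Flat measures on facets -/

section FlatMeasures

variable [FiniteDimensional ℝ E] [MeasurableSpace E] [BorelSpace E]

theorem RestrictsToFlat.measure_lt_top {F : Set E} (hF : IsCompact F) {σ : Measure E}
    (hσ : RestrictsToFlat F σ) : σ F < ∞ := by
  obtain ⟨x₀, -, m, hm, h⟩ := hσ
  have h1 : σ F = (σ.restrict F) F := by simp
  have hemb : IsClosedEmbedding (fun w : vectorSpan ℝ F => (w : E) + x₀) :=
    (Homeomorph.addRight x₀).isClosedEmbedding.comp
      (vectorSpan ℝ F).closed_of_finiteDimensional.isClosedEmbedding_subtypeVal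
  rw [h1, h, Measure.restrict_apply_self, Measure.map_apply hemb.continuous.measurable
    hF.measurableSet]
  exact (hemb.isCompact_preimage hF).measure_lt_top

/-- Fubini's theorem along the direction `e`, transversal to the facet `F`: if lines in the
direction `e` meet `Q` in length at most `a`, the integral over `Q` of a function of the projection
to `F` is bounded by `a` times its integral over `F`. -/
theorem exists_setLIntegral_slide_le (ν : Measure E) [ν.IsAddHaarMeasure] {F : Set E}
    (hF : MeasurableSet F) {ℓ : E →ᵃ[ℝ] ℝ} (hspan : vectorSpan ℝ F = LinearMap.ker ℓ.linear)
    (hF0 : ∀ x ∈ F, ℓ x = 0) {σ : Measure E} (hσ : RestrictsToFlat F σ) {e : E}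
    (he : ℓ.linear e ≠ 0) :
    ∃ C : ℝ≥0, ∀ Q : Set E, MeasurableSet Q → ∀ a : ℝ≥0∞,
      (∀ x, volume {t : ℝ | x + t • e ∈ Q} ≤ a) →
      ∀ f : E → ℝ≥0∞, Measurable (F.indicator f) →
        ∫⁻ x in Q, F.indicator f (slide ℓ e x) ∂ν ≤ C * a * ∫⁻ y in F, f y ∂σ := by
  obtain ⟨x₀, hx₀, m, hm, hσF⟩ := hσ
  have hker : ∀ w : vectorSpan ℝ F, ℓ.linear (w : E) = 0 := fun w =>
    LinearMap.mem_ker.1 (hspan.le w.2)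
  let A : (vectorSpan ℝ F × ℝ) →ₗ[ℝ] E :=
    (vectorSpan ℝ F).subtype.coprod (LinearMap.toSpanSingleton ℝ E e)
  have hA : ∀ w t, A (w, t) = (w : E) + t • e := fun w t => by simp [A]
  have hinj : Function.Injective A := by
    rw [← LinearMap.ker_eq_bot, LinearMap.ker_eq_bot']
    rintro ⟨w, t⟩ h
    rw [hA] at h
    have h1 := congrArg ℓ.linear h
    rw [map_add, hker, map_smul, map_zero, zero_add, smul_eq_mul] at h1
    obtain rfl : t = 0 := (mul_eq_zero.1 h1).resolve_right he
    have : w = 0 := by simpa using h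
    rw [this]; rfl
  have hsurj : Function.Surjective A := by
    intro x
    have hmem : x - (ℓ.linear x / ℓ.linear e) • e ∈ vectorSpan ℝ F := by
      rw [hspan, LinearMap.mem_ker, map_sub, map_smul, smul_eq_mul, div_mul_cancel₀ _ he, sub_self]
    exact ⟨(⟨_, hmem⟩, ℓ.linear x / ℓ.linear e), by rw [hA]; simp⟩
  let T : (vectorSpan ℝ F × ℝ) ≃L[ℝ] E :=
    (LinearEquiv.ofBijective A ⟨hinj, hsurj⟩).toContinuousLinearEquiv
  have hT : ∀ p, T p = (p.1 : E) + p.2 • e := fun p => hA p.1 p.2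
  let ρ : Measure E := (m.prod volume).map T
  have hρ : ρ.IsAddHaarMeasure := T.isAddHaarMeasure_map _
  have hν : ν = Measure.addHaarScalarFactor ν ρ • ρ := Measure.isAddLeftInvariant_eq_smul ν ρ
  refine ⟨Measure.addHaarScalarFactor ν ρ, fun Q hQ a ha f hf => ?_⟩
  set c := Measure.addHaarScalarFactor ν ρ
  set g := F.indicator f with hg
  have hslide : ∀ (w : vectorSpan ℝ F) (t : ℝ),
      slide ℓ e ((w : E) + t • e + x₀) = (w : E) + x₀ := by
    intro w t
    rw [show (w : E) + t • e + x₀ = ((w : E) + x₀) + t • e by abel, slide_add_smul he, slide,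
      add_comm, affine_apply_add, hF0 x₀ hx₀, hker]
    simp
  have hh : Measurable (Q.indicator fun x => g (slide ℓ e x)) :=
    (hf.comp (continuous_slide ℓ e).measurable).indicator hQ
  have hj : Measurable (fun w : vectorSpan ℝ F => (w : E) + x₀) := by fun_prop
  have hR : ∫⁻ y in F, f y ∂σ = ∫⁻ w, g ((w : E) + x₀) ∂m := by
    rw [hσF, ← lintegral_indicator hF, lintegral_map hf hj]
  rw [hR]
  calc ∫⁻ x in Q, g (slide ℓ e x) ∂ν
      = c * ∫⁻ x, Q.indicator (fun x => g (slide ℓ e x)) x ∂ρ := by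
        rw [← lintegral_indicator hQ, hν, lintegral_smul_measure]
        rfl
    _ = c * ∫⁻ x, Q.indicator (fun x => g (slide ℓ e x)) (x + x₀) ∂ρ := by
        rw [lintegral_add_right_eq_self]
    _ = c * ∫⁻ p, Q.indicator (fun x => g (slide ℓ e x)) (T p + x₀) ∂(m.prod volume) := by
        exact congrArg _ (lintegral_map (hh.comp (measurable_add_const x₀)) T.continuous.measurable)
    _ = c * ∫⁻ w, ∫⁻ t, Q.indicator (fun x => g (slide ℓ e x)) (T (w, t) + x₀) ∂volume ∂m := by
        rw [lintegral_prod]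
        exact (hh.comp ((measurable_add_const x₀).comp T.continuous.measurable)).aemeasurable
    _ ≤ c * ∫⁻ w, a * g ((w : E) + x₀) ∂m := by
        gcongr with w
        have hset : MeasurableSet {t : ℝ | ((w : E) + x₀) + t • e ∈ Q} :=
          hQ.preimage (by fun_prop : Continuous fun t : ℝ => ((w : E) + x₀) + t • e).measurable
        have : ∀ t : ℝ, Q.indicator (fun x => g (slide ℓ e x)) (T (w, t) + x₀) =
            {t : ℝ | ((w : E) + x₀) + t • e ∈ Q}.indicator (fun _ => g ((w : E) + x₀)) t := by
          intro t
          rw [hT]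
          have h1 : (w : E) + t • e + x₀ = ((w : E) + x₀) + t • e := by abel
          by_cases h : ((w : E) + x₀) + t • e ∈ Q
          · rw [Set.indicator_of_mem (by rw [h1]; exact h), Set.indicator_of_mem (by exact h),
              hslide]
          · rw [Set.indicator_of_notMem (by rw [h1]; exact h),
              Set.indicator_of_notMem (by exact h)]
        simp_rw [this]
        rw [lintegral_indicator_const hset, mul_comm]
        gcongr
        exact ha _
    _ = c * a * ∫⁻ w, g ((w : E) + x₀) ∂m := by
        rw [mul_assoc]
        exact congrArg _ (lintegral_const_mul _ (hf.comp hj))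

end FlatMeasures

/-! ### The sharp integrability of convex functions -/

open Classical in
/-- The sum of the values of `f` at the points where the line through `x` in the direction `e`
meets the facets of `P`. -/
noncomputable def chordSum (P : Set E) (L : Finset (E →ᵃ[ℝ] ℝ)) (e : E) (f : E → ℝ≥0∞) (x : E) :
    ℝ≥0∞ :=
  ∑ ℓ ∈ L.filter fun ℓ => ℓ.linear e ≠ 0, (P ∩ {y | ℓ y = 0}).indicator f (slide ℓ e x)

theorem chordSum_add_smul (P : Set E) (L : Finset (E →ᵃ[ℝ] ℝ)) (e : E) (f : E → ℝ≥0∞) (x : E)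
    (t : ℝ) : chordSum P L e f (x + t • e) = chordSum P L e f x := by
  classical
  refine Finset.sum_congr rfl fun ℓ hℓ => ?_
  rw [slide_add_smul (Finset.mem_filter.1 hℓ).2]

theorem slide_neg (ℓ : E →ᵃ[ℝ] ℝ) (e x : E) : slide ℓ (-e) x = slide ℓ e x := by
  simp [slide, div_neg]

theorem le_chordSum {P : Set E} {L : Finset (E →ᵃ[ℝ] ℝ)} {ℓ : E →ᵃ[ℝ] ℝ} (hℓ : ℓ ∈ L) {e : E}
    (he : ℓ.linear e ≠ 0) (f : E → ℝ≥0∞) {x : E} (hx : slide ℓ e x ∈ P ∩ {y | ℓ y = 0}) :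
    f (slide ℓ e x) ≤ chordSum P L e f x := by
  classical
  have := Finset.single_le_sum (f := fun ℓ : E →ᵃ[ℝ] ℝ =>
    (P ∩ {y | ℓ y = 0}).indicator f (slide ℓ e x)) (fun _ _ => zero_le)
    (Finset.mem_filter.2 ⟨hℓ, he⟩ : ℓ ∈ L.filter fun ℓ => ℓ.linear e ≠ 0)
  rwa [Set.indicator_of_mem hx] at this

/-- A convex function on a polytope is bounded by its values at the two endpoints of a chord. -/
theorem IsConvexFun.le_chordSum {P : Set E} (hP : IsCompact P) {L : Finset (E →ᵃ[ℝ] ℝ)}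
    (hL : IsFacetPresentation P L) {u : E → ℝ≥0∞} (hu : IsConvexFun P u) {e : E} (he : e ≠ 0)
    {x : E} (hx : x ∈ P) : u x ≤ chordSum P L e u x := by
  obtain ⟨ℓ, hℓ, hℓe, hmem, t, ht, heq⟩ := hL.exists_exit hP he hx
  obtain ⟨ℓ', hℓ', hℓe', hmem', t', ht', heq'⟩ := hL.exists_exit hP (neg_ne_zero.2 he) hx
  rw [slide_neg] at hmem' heq'
  have hseg : x ∈ segment ℝ (slide ℓ e x) (slide ℓ' e x) := by
    rw [heq, heq']
    rcases (add_nonneg ht ht').eq_or_lt with h0 | h0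
    · obtain rfl : t = 0 := by linarith
      simpa using left_mem_segment ℝ x _
    · refine ⟨t' / (t + t'), t / (t + t'), by positivity, by positivity, by field_simp; ring, ?_⟩
      match_scalars
      · field_simp; ring
      · field_simp; ring
  refine (hu.le_max_of_mem_segment hmem.1 hmem'.1 hseg).trans (max_le ?_ ?_)
  · exact FlatPolytope.le_chordSum hℓ hℓe u hmem
  · exact FlatPolytope.le_chordSum hℓ' (by simpa using hℓe') u hmem'

theorem isClosed_facet [FiniteDimensional ℝ E] {P : Set E} (hP : IsClosed P) (ℓ : E →ᵃ[ℝ] ℝ) :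
    IsClosed (P ∩ {y | ℓ y = 0}) :=
  hP.inter (isClosed_eq ℓ.continuous_of_finiteDimensional continuous_const)

section

variable [FiniteDimensional ℝ E] [MeasurableSpace E] [BorelSpace E]

theorem measurable_chordSum {P : Set E} {L : Finset (E →ᵃ[ℝ] ℝ)} {e : E} {f : E → ℝ≥0∞}
    (hf : ∀ ℓ ∈ L, Measurable ((P ∩ {y | ℓ y = 0}).indicator f)) :
    Measurable (chordSum P L e f) := by
  classical
  exact Finset.measurable_fun_sum _ fun ℓ hℓ =>
    (hf ℓ (Finset.mem_filter.1 hℓ).1).comp (continuous_slide ℓ e).measurable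

theorem exists_setLIntegral_chordSum_le (ν : Measure E) [ν.IsAddHaarMeasure] {P : Set E}
    (hP : IsClosed P) {L : Finset (E →ᵃ[ℝ] ℝ)} (hL : IsFacetPresentation P L) {σ : Measure E}
    (hσ : IsFlatBoundaryMeasure P σ) (e : E) :
    ∃ C : ℝ≥0, ∀ Q : Set E, MeasurableSet Q → ∀ a : ℝ≥0∞,
      (∀ x, volume {t : ℝ | x + t • e ∈ Q} ≤ a) →
      ∀ f : E → ℝ≥0∞, (∀ ℓ ∈ L, Measurable ((P ∩ {y | ℓ y = 0}).indicator f)) →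
        ∫⁻ x in Q, chordSum P L e f x ∂ν ≤ C * a * ∫⁻ y in frontier P, f y ∂σ := by
  classical
  have key : ∀ ℓ : {ℓ // ℓ ∈ L.filter fun ℓ => ℓ.linear e ≠ 0}, ∃ C : ℝ≥0, ∀ Q : Set E,
      MeasurableSet Q → ∀ a : ℝ≥0∞, (∀ x, volume {t : ℝ | x + t • e ∈ Q} ≤ a) →
      ∀ f : E → ℝ≥0∞, Measurable ((P ∩ {y | ℓ.1 y = 0}).indicator f) →
        ∫⁻ x in Q, (P ∩ {y | ℓ.1 y = 0}).indicator f (slide ℓ.1 e x) ∂ν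
          ≤ C * a * ∫⁻ y in P ∩ {y | ℓ.1 y = 0}, f y ∂σ := fun ℓ => by
    obtain ⟨hℓ, he⟩ := Finset.mem_filter.1 ℓ.2
    exact exists_setLIntegral_slide_le ν (isClosed_facet hP ℓ.1).measurableSet
      (hL.vectorSpan_eq ℓ.1 hℓ) (fun x hx => hx.2) (hσ.flat _ (hL.isFacet ℓ.1 hℓ)) he
  choose C hC using key
  refine ⟨∑ ℓ, C ℓ, fun Q hQ a ha f hf => ?_⟩
  have hterm : ∀ ℓ ∈ L.filter fun ℓ => ℓ.linear e ≠ 0,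
      Measurable fun x => (P ∩ {y | ℓ y = 0}).indicator f (slide ℓ e x) := fun ℓ hℓ =>
    (hf ℓ (Finset.mem_filter.1 hℓ).1).comp (continuous_slide ℓ e).measurable
  unfold chordSum
  rw [lintegral_finsetSum _ hterm, ← Finset.sum_coe_sort]
  push_cast
  rw [Finset.sum_mul, Finset.sum_mul]
  refine Finset.sum_le_sum fun ℓ _ => ?_
  have hℓ := (Finset.mem_filter.1 ℓ.2).1
  refine (hC ℓ Q hQ a ha f (hf ℓ.1 hℓ)).trans ?_
  gcongr
  exact hL.facet_subset_frontier hℓ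

/-- Convex functions with integrable boundary values lie in `L^(n/(n-1))`. Along each coordinate
direction the function is bounded by its two boundary values on the chord, a function that does not
depend on that coordinate, so the Gagliardo-Nirenberg grid-lines lemma applies. -/
theorem exists_lintegral_rpow_le (ν : Measure E) [ν.IsAddHaarMeasure] {n : ℕ} (hn : 1 < n)
    (hE : finrank ℝ E = n) {P : Set E} (hP : IsPolytope P) {σ : Measure E}
    (hσ : IsFlatBoundaryMeasure P σ) :
    ∃ K : ℝ≥0, ∀ u : E → ℝ≥0∞, LowerSemicontinuousOn u P → IsConvexFun P u →
      ∫⁻ x in P, u x ^ ((n : ℝ) / (n - 1)) ∂ν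
        ≤ K * (∫⁻ y in frontier P, u y ∂σ) ^ ((n : ℝ) / (n - 1)) := by
  obtain ⟨L, hL⟩ := hP.exists_isFacetPresentation
  have hn' : (1 : ℝ) < n := by exact_mod_cast hn
  have hconj : Real.HolderConjugate (Fintype.card (Fin n)) ((n : ℝ) / (n - 1)) := by
    rw [Fintype.card_fin]
    exact Real.HolderConjugate.conjExponent hn'
  set p : ℝ := (n : ℝ) / (n - 1) with hp
  have hp0 : 0 < p := by have : (0 : ℝ) < n - 1 := by linarith
                         positivity
  let b : Basis (Fin n) ℝ E := finBasisOfFinrankEq ℝ E hE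
  let φ : E ≃L[ℝ] (Fin n → ℝ) := b.equivFun.toContinuousLinearEquiv
  have hφb : ∀ i, φ (b i) = Pi.single i 1 := fun i => by
    ext j
    rw [Pi.single_apply]
    exact (b.equivFun_self i j).trans (if_congr eq_comm rfl rfl)
  let ρ : Measure E := (volume : Measure (Fin n → ℝ)).map φ.symm
  have hρ : ρ.IsAddHaarMeasure := φ.symm.isAddHaarMeasure_map _
  obtain ⟨c, hν⟩ : ∃ c : ℝ≥0, ν = c • ρ := ⟨_, Measure.isAddLeftInvariant_eq_smul ν ρ⟩
  obtain ⟨R, hR1, hR⟩ : ∃ R : ℝ, 1 ≤ R ∧ ∀ x ∈ P, ‖φ x‖ ≤ R := by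
    obtain ⟨R, hR⟩ := (hP.isCompact.image φ.continuous).isBounded.exists_norm_le
    exact ⟨max R 1, le_max_right _ _, fun x hx =>
      (hR _ (Set.mem_image_of_mem _ hx)).trans (le_max_left _ _)⟩
  set I : Set ℝ := Set.Icc (-R) R
  have hI : volume I = ENNReal.ofReal (2 * R) := by
    rw [Real.volume_Icc]; congr 1; ring
  let B : Set E := φ ⁻¹' (Set.univ.pi fun _ => I)
  have hBm : MeasurableSet B :=
    (MeasurableSet.univ_pi fun _ => measurableSet_Icc).preimage φ.continuous.measurable
  have hPB : P ⊆ B := fun x hx i _ => abs_le.1 ((norm_le_pi_norm (φ x) i).trans (hR x hx))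
  have hline : ∀ i x, volume {t : ℝ | x + t • b i ∈ B} ≤ ENNReal.ofReal (2 * R) := by
    intro i x
    have hsub : {t : ℝ | x + t • b i ∈ B} ⊆ Set.Icc (-R - φ x i) (R - φ x i) := by
      intro t ht
      have h1 := ht i trivial
      rw [map_add, map_smul, hφb] at h1
      simp only [Pi.add_apply, Pi.smul_apply, Pi.single_eq_same, smul_eq_mul, mul_one, I,
        Set.mem_Icc] at h1
      exact ⟨by linarith, by linarith⟩
    refine (measure_mono hsub).trans_eq ?_
    rw [Real.volume_Icc]; congr 1; ring
  choose C hC using fun i => exists_setLIntegral_chordSum_le ρ hP.isClosed hL hσ (b i)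
  refine ⟨c * ((∑ i, C i) * (2 * R).toNNReal) ^ p,
    fun u hu hconv => ?_⟩
  have hmeas : ∀ ℓ ∈ L, Measurable ((P ∩ {y | ℓ y = 0}).indicator u) := fun ℓ _ =>
    measurable_indicator_of_lowerSemicontinuousOn hu (isClosed_facet hP.isClosed ℓ)
      Set.inter_subset_left
  let G : Fin n → E → ℝ≥0∞ := fun i => chordSum P L (b i) u
  have hG : ∀ i, Measurable (G i) := fun i => measurable_chordSum hmeas
  let f : (Fin n → ℝ) → ℝ≥0∞ := fun y => ∑ i, G i (φ.symm y)
  have hGφ : ∀ i, Measurable fun y => G i (φ.symm y) := fun i =>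
    (hG i).comp φ.symm.continuous.measurable
  have hf : Measurable f := Finset.measurable_fun_sum _ fun i _ => hGφ i
  let m : Fin n → Measure ℝ := fun _ => volume.restrict I
  have hm : Measure.pi m = (volume : Measure (Fin n → ℝ)).restrict (Set.univ.pi fun _ => I) := by
    rw [volume_pi, Measure.restrict_pi_pi]
  -- the mass of `f` on the box is controlled by the boundary integral
  have hfint : ∫⁻ y, f y ∂Measure.pi m
      ≤ (((∑ i, C i) * (2 * R).toNNReal : ℝ≥0) : ℝ≥0∞) * ∫⁻ y in frontier P, u y ∂σ := by
    rw [hm, lintegral_finsetSum _ fun i _ => hGφ i]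
    push_cast
    rw [Finset.sum_mul, Finset.sum_mul]
    refine Finset.sum_le_sum fun i _ => ?_
    have h1 := hC i B hBm _ (hline i) u hmeas
    rw [setLIntegral_map hBm (hG i) φ.symm.continuous.measurable] at h1
    have h2 : φ.symm ⁻¹' B = Set.univ.pi fun _ => I := by
      ext y; simp [B]
    rwa [h2] at h1
  have hupd : ∀ (y : Fin n → ℝ) (i : Fin n) (t : ℝ),
      φ.symm (Function.update y i t) = φ.symm y + (t - y i) • b i := by
    intro y i t
    apply φ.injective
    rw [φ.apply_symm_apply, map_add, map_smul, hφb, φ.apply_symm_apply]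
    ext j
    by_cases hj : j = i
    · subst hj; simp
    · simp [hj]
  -- `G i` does not depend on the `i`-th coordinate
  have hGle : ∀ (y : Fin n → ℝ) (i : Fin n),
      G i (φ.symm y) ≤ ∫⁻ t, f (Function.update y i t) ∂m i := by
    intro y i
    calc G i (φ.symm y) ≤ G i (φ.symm y) * volume I := by
          rw [hI]
          refine le_mul_of_one_le_right zero_le (ENNReal.one_le_ofReal.2 (by linarith))
      _ = ∫⁻ t, G i (φ.symm y) ∂m i := by rw [lintegral_const, Measure.restrict_apply_univ]
      _ ≤ ∫⁻ t, f (Function.update y i t) ∂m i := by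
          refine lintegral_mono fun t => ?_
          have h := chordSum_add_smul P L (b i) u (φ.symm y) (t - y i)
          rw [← hupd] at h
          change chordSum P L (b i) u (φ.symm y) ≤ ∑ j, G j (φ.symm (Function.update y i t))
          rw [← h]
          exact Finset.single_le_sum (f := fun j => G j (φ.symm (Function.update y i t)))
            (fun _ _ => zero_le) (Finset.mem_univ i)
  have hcard : (Fintype.card (Fin n) : ℝ) - 1 = n - 1 := by rw [Fintype.card_fin]
  have hpow : ∀ a : ℝ≥0∞, a ^ p = ∏ _i : Fin n, a ^ ((1 : ℝ) / (Fintype.card (Fin n) - 1 : ℝ)) := by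
    intro a
    rw [Finset.prod_const, Finset.card_univ, ← ENNReal.rpow_natCast, ← ENNReal.rpow_mul,
      Fintype.card_fin, hp]
    congr 1
    ring
  have hmain : ∫⁻ x in P, u x ^ p ∂ρ ≤ (∫⁻ y, f y ∂Measure.pi m) ^ p := by
    refine le_trans ?_ (lintegral_prod_lintegral_pow_le m hconj hf)
    have hemb : MeasurableEmbedding φ.symm := φ.symm.toHomeomorph.measurableEmbedding
    rw [← lintegral_indicator hP.isClosed.measurableSet, hemb.lintegral_map, hm,
      ← lintegral_indicator (MeasurableSet.univ_pi fun _ => measurableSet_Icc)]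
    refine lintegral_mono fun y => ?_
    by_cases hy : φ.symm y ∈ P
    · have hyB : y ∈ Set.univ.pi fun _ : Fin n => I := by
        have := hPB hy
        simpa [B] using this
      rw [Set.indicator_of_mem hyB]
      refine (Set.indicator_of_mem hy _).trans_le ?_
      rw [hpow]
      refine Finset.prod_le_prod' fun i _ => ?_
      have hexp : (0 : ℝ) ≤ 1 / (Fintype.card (Fin n) - 1 : ℝ) := by
        rw [hcard]; exact div_nonneg zero_le_one (by linarith)
      refine ENNReal.rpow_le_rpow ?_ hexp
      exact (hconv.le_chordSum hP.isCompact hL (b.ne_zero i) hy).trans (hGle y i)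
    · exact (Set.indicator_of_notMem hy _).trans_le zero_le
  rw [hν, Measure.restrict_smul, lintegral_smul_measure, ENNReal.smul_def, smul_eq_mul,
    ENNReal.coe_mul, ENNReal.coe_rpow_of_nonneg _ hp0.le, mul_assoc,
    ← ENNReal.mul_rpow_of_nonneg _ _ hp0.le]
  gcongr
  exact hmain.trans (ENNReal.rpow_le_rpow hfint hp0.le)

end

/-! ### Caps of the boundary -/

theorem _root_.Convex.add_sum_smul_mem {ι : Type*} [Fintype ι] {P : Set E} (hP : Convex ℝ P)
    {k : E} (hk : k ∈ P) {w : ι → E} (hw : ∀ i, k + w i ∈ P) {c : ι → ℝ} (hc : ∀ i, 0 ≤ c i)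
    (hc1 : ∑ i, c i ≤ 1) : k + ∑ i, c i • w i ∈ P := by
  have h := hP.sum_mem (t := Finset.univ) (w := fun o : Option ι => o.elim (1 - ∑ i, c i) c)
    (z := fun o : Option ι => o.elim k fun i => k + w i)
    (by rintro (_ | i) -; exacts [sub_nonneg.2 hc1, hc i])
    (by rw [Fintype.sum_option]; simp)
    (by rintro (_ | i) -; exacts [hk, hw i])
  rw [Fintype.sum_option] at h
  convert h using 1
  simp only [Option.elim, smul_add, Finset.sum_add_distrib, ← Finset.sum_smul]
  module

section

variable [FiniteDimensional ℝ E] [MeasurableSpace E] [BorelSpace E]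

theorem IsFlatBoundaryMeasure.measure_frontier_lt_top {P : Set E} (hP : IsPolytope P)
    {σ : Measure E} (hσ : IsFlatBoundaryMeasure P σ) : σ (frontier P) < ∞ := by
  obtain ⟨L, hL⟩ := hP.exists_isFacetPresentation
  refine (measure_mono (hL.frontier_subset hP.isClosed)).trans_lt
    ((measure_biUnion_finset_le _ _).trans_lt (ENNReal.sum_lt_top.2 fun ℓ hℓ => ?_))
  exact (hσ.flat _ (hL.isFacet ℓ hℓ)).measure_lt_top
    (hP.isCompact.inter_right (isClosed_eq ℓ.continuous_of_finiteDimensional continuous_const))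

/-- A half space whose boundary passes through the centre `x` of a box contained in `P` cuts off a
large part of the boundary of `P`: it contains half of the box, and rays in one of the directions
`± w m` carry this half to the part of the boundary in the half space. -/
theorem exists_prod_le_mul_measure_cap {n : ℕ} (w : Basis (Fin n) ℝ E) {P : Set E}
    (hP : IsPolytope P) {σ : Measure E} (hσ : IsFlatBoundaryMeasure P σ) :
    ∃ K : ℝ≥0, ∀ (x : E) (a : Fin n → ℝ), (∀ i, 0 < a i) →
      (∀ s : Fin n → ℝ, (∀ i, |s i| ≤ a i) → x + ∑ i, s i • w i ∈ P) →
      ∀ (g : E →L[ℝ] ℝ) (m : Fin n), ∏ i, ENNReal.ofReal (a i)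
        ≤ K * ENNReal.ofReal (a m) * σ (frontier P ∩ {y | g x ≤ g y}) := by
  obtain ⟨L, hL⟩ := hP.exists_isFacetPresentation
  let φ : E ≃L[ℝ] (Fin n → ℝ) := w.equivFun.toContinuousLinearEquiv
  have hφw : ∀ i, φ (w i) = Pi.single i 1 := fun i => by
    ext j
    rw [Pi.single_apply]
    exact (w.equivFun_self i j).trans (if_congr eq_comm rfl rfl)
  have hsum : ∀ y, ∑ i, φ y i • w i = y := fun y => w.sum_equivFun y
  let ρ : Measure E := (volume : Measure (Fin n → ℝ)).map φ.symm
  have hρ : ρ.IsAddHaarMeasure := φ.symm.isAddHaarMeasure_map _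
  choose C hC using fun i => exists_setLIntegral_chordSum_le ρ hP.isClosed hL hσ (w i)
  refine ⟨4 * ∑ i, C i, fun x a ha hbox g m => ?_⟩
  let Q : Set E := φ ⁻¹' Set.Icc (φ x - a) (φ x + a)
  have hQm : MeasurableSet Q := measurableSet_Icc.preimage φ.continuous.measurable
  have hQ : ∀ y, y ∈ Q ↔ ∀ i, |φ y i - φ x i| ≤ a i := by
    intro y
    simp only [Q, Set.mem_preimage, Set.mem_Icc, Pi.le_def, Pi.sub_apply, Pi.add_apply, abs_le,
      ← forall_and]
    exact forall_congr' fun i => ⟨fun h => ⟨by linarith, by linarith⟩,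
      fun h => ⟨by linarith, by linarith⟩⟩
  have hQP : Q ⊆ P := by
    intro y hy
    have h := hbox (fun i => φ y i - φ x i) ((hQ y).1 hy)
    have h2 : ∑ i, (φ y i - φ x i) • w i = y - x := by
      rw [← hsum (y - x)]; simp
    rwa [h2, add_sub_cancel] at h
  have hvol : ∏ i, ENNReal.ofReal (a i) ≤ ρ Q := by
    have h1 : ρ Q = volume (Set.Icc (φ x - a) (φ x + a)) := by
      rw [Measure.map_apply φ.symm.continuous.measurable hQm]
      congr 1
      ext y; simp [Q]
    rw [h1, Real.volume_Icc_pi]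
    refine Finset.prod_le_prod' fun i _ => ENNReal.ofReal_le_ofReal ?_
    simp only [Pi.add_apply, Pi.sub_apply]
    linarith [ha i]
  set H : Set E := {y | g x ≤ g y} with hH
  have hHc : IsClosed H := isClosed_le continuous_const g.continuous
  have hrefl : ρ Q ≤ 2 * ρ (Q ∩ H) := by
    have hmp : MeasurePreserving (fun y => (x + x) - y) ρ ρ :=
      Measure.measurePreserving_sub_left ρ (x + x)
    have hpre := hmp.measure_preimage (hQm.inter hHc.measurableSet).nullMeasurableSet
    have hcover : Q ⊆ (Q ∩ H) ∪ (fun y => (x + x) - y) ⁻¹' (Q ∩ H) := by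
      intro y hy
      rcases le_total (g x) (g y) with h | h
      · exact Or.inl ⟨hy, h⟩
      · refine Or.inr ⟨(hQ _).2 fun i => ?_, ?_⟩
        · have := (hQ y).1 hy i
          rw [map_sub, map_add, Pi.sub_apply, Pi.add_apply, ← abs_neg]
          convert this using 2
          ring
        · simp only [hH, Set.mem_ofPred_eq, map_sub, map_add]
          linarith
    calc ρ Q ≤ ρ (Q ∩ H) + ρ ((fun y => (x + x) - y) ⁻¹' (Q ∩ H)) :=
          (measure_mono hcover).trans (measure_union_le _ _)
      _ = 2 * ρ (Q ∩ H) := by rw [hpre, two_mul]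
  have hline : ∀ z, volume {t : ℝ | z + t • w m ∈ Q} ≤ ENNReal.ofReal (2 * a m) := by
    intro z
    have hsub : {t : ℝ | z + t • w m ∈ Q} ⊆
        Set.Icc (φ x m - a m - φ z m) (φ x m + a m - φ z m) := by
      intro t ht
      have h1 := abs_le.1 ((hQ _).1 ht m)
      rw [map_add, map_smul, hφw] at h1
      simp only [Pi.add_apply, Pi.smul_apply, Pi.single_eq_same, smul_eq_mul, mul_one] at h1
      exact ⟨by linarith, by linarith⟩
    refine (measure_mono hsub).trans_eq ?_
    rw [Real.volume_Icc]; congr 1; ring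
  let f : E → ℝ≥0∞ := H.indicator fun _ => 1
  have hf : Measurable f := measurable_const.indicator hHc.measurableSet
  have hray : ∀ y ∈ Q ∩ H, 1 ≤ chordSum P L (w m) f y := by
    rintro y ⟨hyQ, hyH⟩
    have hexit : ∀ e : E, (e = w m ∨ e = -w m) → 0 ≤ g e → 1 ≤ chordSum P L (w m) f y := by
      intro e he hge
      have he0 : e ≠ 0 := by
        rcases he with rfl | rfl
        exacts [w.ne_zero m, neg_ne_zero.2 (w.ne_zero m)]
      obtain ⟨ℓ, hℓ, hℓe, hmem, t, ht, heq⟩ := hL.exists_exit hP.isCompact he0 (hQP hyQ)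
      have hs : slide ℓ e y = slide ℓ (w m) y := by
        rcases he with rfl | rfl
        exacts [rfl, slide_neg _ _ _]
      have hℓw : ℓ.linear (w m) ≠ 0 := by
        rcases he with rfl | rfl
        exacts [hℓe, by simpa using hℓe]
      have hin : slide ℓ e y ∈ H := by
        simp only [hH, Set.mem_ofPred_eq, heq, map_add, map_smul, smul_eq_mul]
        have h1 : g x ≤ g y := hyH
        have h2 := mul_nonneg ht hge
        linarith
      rw [hs] at hmem hin
      refine le_trans ?_ (le_chordSum hℓ hℓw f hmem)
      rw [show f (slide ℓ (w m) y) = 1 from Set.indicator_of_mem hin _]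
    rcases le_total 0 (g (w m)) with h | h
    · exact hexit _ (Or.inl rfl) h
    · exact hexit _ (Or.inr rfl) (by rw [map_neg]; linarith)
  have hcap : ρ (Q ∩ H) ≤ C m * ENNReal.ofReal (2 * a m) * σ (frontier P ∩ H) := by
    calc ρ (Q ∩ H) = ∫⁻ _ in Q ∩ H, 1 ∂ρ := by simp
      _ ≤ ∫⁻ y in Q ∩ H, chordSum P L (w m) f y ∂ρ :=
          setLIntegral_mono' (hQm.inter hHc.measurableSet) hray
      _ ≤ ∫⁻ y in Q, chordSum P L (w m) f y ∂ρ := lintegral_mono_set Set.inter_subset_left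
      _ ≤ C m * ENNReal.ofReal (2 * a m) * ∫⁻ y in frontier P, f y ∂σ :=
          hC m Q hQm _ hline f fun ℓ _ => hf.indicator (isClosed_facet hP.isClosed ℓ).measurableSet
      _ = C m * ENNReal.ofReal (2 * a m) * σ (frontier P ∩ H) := by
          rw [lintegral_indicator hHc.measurableSet, setLIntegral_one,
            Measure.restrict_apply hHc.measurableSet, Set.inter_comm]
  calc ∏ i, ENNReal.ofReal (a i) ≤ 2 * ρ (Q ∩ H) := hvol.trans hrefl
    _ ≤ 2 * (C m * ENNReal.ofReal (2 * a m) * σ (frontier P ∩ H)) := by gcongr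
    _ = ((4 * C m : ℝ≥0) : ℝ≥0∞) * ENNReal.ofReal (a m) * σ (frontier P ∩ H) := by
        rw [ENNReal.ofReal_mul zero_le_two, ENNReal.ofReal_ofNat]
        push_cast
        ring
    _ ≤ _ := by
        gcongr
        exact Finset.single_le_sum (fun _ _ => zero_le) (Finset.mem_univ m)

/-- If a box centred at `x` is contained in `P`, a lower semicontinuous convex function with
boundary integral at most one is bounded at `x` in terms of the side lengths of the box: it exceeds
any value below `u x` on a half space through `x`, whose boundary cap has large measure. -/
theorem exists_mul_prod_le {n : ℕ} (w : Basis (Fin n) ℝ E) {P : Set E}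
    (hP : IsPolytope P) {σ : Measure E} (hσ : IsFlatBoundaryMeasure P σ) :
    ∃ K : ℝ≥0, ∀ (x : E) (a : Fin n → ℝ), (∀ i, 0 < a i) →
      (∀ s : Fin n → ℝ, (∀ i, |s i| ≤ a i) → x + ∑ i, s i • w i ∈ P) →
      ∀ u : E → ℝ≥0∞, LowerSemicontinuousOn u P → IsConvexFun P u →
        ∫⁻ y in frontier P, u y ∂σ ≤ 1 →
        ∀ m, u x * ∏ i, ENNReal.ofReal (a i) ≤ K * ENNReal.ofReal (a m) := by
  obtain ⟨K, hK⟩ := exists_prod_le_mul_measure_cap w hP hσ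
  refine ⟨K, fun x a ha hbox u hu hconv hint m => ?_⟩
  have hx : x ∈ P := by simpa using hbox 0 fun i => by simpa using (ha i).le
  have hD0 : ∏ i, ENNReal.ofReal (a i) ≠ 0 := Finset.prod_ne_zero_iff.2 fun i _ => by
    simpa using ha i
  have hDtop : ∏ i, ENNReal.ofReal (a i) ≠ ∞ := ENNReal.prod_ne_top fun _ _ => ENNReal.ofReal_ne_top
  rw [← ENNReal.le_div_iff_mul_le (Or.inl hD0) (Or.inl hDtop)]
  refine le_of_forall_lt fun τ hτ => ?_
  obtain ⟨τ', hττ', hτ'⟩ := exists_between hτ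
  refine hττ'.trans_le ?_
  rw [ENNReal.le_div_iff_mul_le (Or.inl hD0) (Or.inl hDtop)]
  have hclosed : IsClosed {y ∈ P | u y ≤ τ'} := by
    obtain ⟨O, hO, h⟩ := lowerSemicontinuousOn_iff_preimage_Ioi.1 hu τ'
    have : {y ∈ P | u y ≤ τ'} = P ∩ Oᶜ := by
      ext y
      have hy : y ∈ P ∩ u ⁻¹' Set.Ioi τ' ↔ y ∈ P ∩ O := by rw [h]
      simp only [Set.mem_inter_iff, Set.mem_preimage, Set.mem_Ioi] at hy
      simp only [Set.mem_inter_iff, Set.mem_compl_iff, Set.mem_ofPred_eq, ← not_lt]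
      tauto
    rw [this]
    exact hP.isClosed.inter hO.isClosed_compl
  obtain ⟨g, c, hg, hgx⟩ := geometric_hahn_banach_closed_point
    (hconv.convex_setOf_le hP.convex τ') hclosed (x := x) (fun h => absurd hτ' (not_lt.2 h.2))
  have hcapm : MeasurableSet (frontier P ∩ {y | g x ≤ g y}) :=
    (isClosed_frontier.inter (isClosed_le continuous_const g.continuous)).measurableSet
  have hcap : τ' * σ (frontier P ∩ {y | g x ≤ g y}) ≤ 1 := by
    rw [← setLIntegral_const]
    refine le_trans (setLIntegral_mono' hcapm fun y hy => ?_)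
      ((lintegral_mono_set Set.inter_subset_left).trans hint)
    by_contra! hlt
    have h1 := hg y ⟨hP.isClosed.frontier_subset hy.1, hlt.le⟩
    have h2 : g x ≤ g y := hy.2
    linarith
  calc τ' * ∏ i, ENNReal.ofReal (a i)
      ≤ τ' * (K * ENNReal.ofReal (a m) * σ (frontier P ∩ {y | g x ≤ g y})) := by
        gcongr; exact hK x a ha hbox g m
    _ = K * ENNReal.ofReal (a m) * (τ' * σ (frontier P ∩ {y | g x ≤ g y})) := by ring
    _ ≤ K * ENNReal.ofReal (a m) * 1 := by gcongr
    _ = _ := mul_one _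

end

/-! ### The envelope of convex functions with bounded boundary integral -/

/-- The pointwise supremum of all lower semicontinuous convex functions on `P` whose boundary
integral is at most one. -/
noncomputable def boundaryEnvelope [MeasurableSpace E] (P : Set E) (σ : Measure E) (x : E) :
    ℝ≥0∞ :=
  ⨆ u : {u : E → ℝ≥0∞ // LowerSemicontinuousOn u P ∧ IsConvexFun P u ∧
    ∫⁻ y in frontier P, u y ∂σ ≤ 1}, u.1 x

section

variable [MeasurableSpace E]

theorem lowerSemicontinuousOn_boundaryEnvelope (P : Set E) (σ : Measure E) :
    LowerSemicontinuousOn (boundaryEnvelope P σ) P :=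
  lowerSemicontinuousOn_iSup fun u => u.2.1

theorem isConvexFun_boundaryEnvelope (P : Set E) (σ : Measure E) :
    IsConvexFun P (boundaryEnvelope P σ) :=
  IsConvexFun.iSup fun u => u.2.2.1

theorem le_boundaryEnvelope {P : Set E} {σ : Measure E} {u : E → ℝ≥0∞}
    (hu : LowerSemicontinuousOn u P) (hconv : IsConvexFun P u)
    (h : ∫⁻ y in frontier P, u y ∂σ ≤ 1) (x : E) : u x ≤ boundaryEnvelope P σ x :=
  le_iSup (fun u : {u : E → ℝ≥0∞ // LowerSemicontinuousOn u P ∧ IsConvexFun P u ∧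
    ∫⁻ y in frontier P, u y ∂σ ≤ 1} => u.1 x) ⟨u, hu, hconv, h⟩

theorem boundaryEnvelope_pos {P : Set E} {σ : Measure E} (hσ : σ (frontier P) ≠ ∞) (x : E) :
    0 < boundaryEnvelope P σ x := by
  have htop : σ (frontier P) + 1 ≠ ∞ := by simpa using hσ
  refine lt_of_lt_of_le (ENNReal.inv_pos.2 htop) (le_boundaryEnvelope (σ := σ)
    (u := fun _ => (σ (frontier P) + 1)⁻¹) lowerSemicontinuousOn_const (isConvexFun_const _ _) ?_ x)
  rw [setLIntegral_const, mul_comm, ← div_eq_mul_inv]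
  exact ENNReal.div_le_of_le_mul (by rw [one_mul]; exact le_self_add)

end

section

variable [FiniteDimensional ℝ E] [MeasurableSpace E] [BorelSpace E]

theorem IsConvexFun.ne_top_of_ae {P : Set E} (hP : IsPolytope P) {u : E → ℝ≥0∞}
    (hu : IsConvexFun P u) {ν : Measure E} [ν.IsAddHaarMeasure]
    (h : ∀ᵐ x ∂ν.restrict P, u x ≠ ∞) : ∀ x ∈ interior P, u x ≠ ∞ := by
  suffices interior P ⊆ {x ∈ P | u x ≠ ∞} from fun x hx => (this hx).2
  refine (hu.convex_setOf_ne_top hP.convex).subset_of_isOpen_of_subset_closure isOpen_interior ?_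
  rw [ae_restrict_iff' hP.isClosed.measurableSet] at h
  have hd := Measure.dense_of_ae h
  refine (hd.open_subset_closure_inter isOpen_interior).trans (closure_mono fun x hx => ?_)
  exact ⟨interior_subset hx.1, hx.2 (interior_subset hx.1)⟩

/-- Almost all of a polytope is covered by finitely many pieces of simplices spanned by vertices:
the points of the simplex with vertices `k` and `k + w i` for which the barycentric coordinate
belonging to `k` is the largest one. -/
theorem IsPolytope.exists_finite_cover {n : ℕ} (hn : 1 ≤ n) (hE : finrank ℝ E = n) {P : Set E}
    (hP : IsPolytope P) (ν : Measure E) [ν.IsAddHaarMeasure] :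
    ∃ T : Set (E × Basis (Fin n) ℝ E), T.Finite ∧ (∀ t ∈ T, t.1 ∈ P ∧ ∀ i, t.1 + t.2 i ∈ P) ∧
      ∀ᵐ x ∂ν.restrict P, ∃ t ∈ T, ∃ c : Fin n → ℝ, (∀ i, 0 < c i) ∧ (∀ i, c i ≤ 1 - ∑ j, c j) ∧
        x = t.1 + ∑ i, c i • t.2 i := by
  classical
  obtain ⟨S, hS⟩ := hP.exists_eq_convexHull
  have hSP : (S : Set E) ⊆ P := by rw [hS]; exact subset_convexHull ℝ _
  refine ⟨{t | t.1 ∈ S ∧ ∀ i, t.1 + t.2 i ∈ S}, ?_, fun t ht => ⟨hSP ht.1, fun i => hSP (ht.2 i)⟩,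
    ?_⟩
  · refine Set.Finite.of_injOn
      (f := fun t : E × Basis (Fin n) ℝ E => (t.1, fun i => t.1 + t.2 i))
      (t := (S : Set E) ×ˢ Set.univ.pi fun _ => (S : Set E)) (fun t ht => ⟨ht.1, fun i _ => ht.2 i⟩)
      ?_ (S.finite_toSet.prod (Set.Finite.pi fun _ => S.finite_toSet))
    rintro ⟨k, w⟩ - ⟨k', w'⟩ - h
    simp only [Prod.mk.injEq] at h
    obtain ⟨rfl, h⟩ := h
    have : w = w' := Basis.eq_of_apply_eq fun i => by simpa using congrFun h i
    rw [this]
  · rw [ae_restrict_iff' hP.isClosed.measurableSet]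
    -- points in the span of fewer than `n + 1` affinely independent vertices form a null set
    have hnull : ν (⋃ A ∈ {A : Set E | A ⊆ S ∧ affineSpan ℝ A ≠ ⊤}, (affineSpan ℝ A : Set E)) = 0 :=
      (measure_biUnion_null_iff
        ((S.finite_toSet.finite_subsets.subset fun A hA => hA.1).countable)).2
        fun A hA => Measure.addHaar_affineSubspace ν _ hA.2
    filter_upwards [measure_eq_zero_iff_ae_notMem.1 hnull] with x hx hxP
    rw [hS] at hxP
    obtain ⟨ι, _, z, c, hzS, hz, hc, hc1, hcx⟩ := eq_pos_convex_span_of_mem_convexHull hxP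
    have hcard : Fintype.card ι = finrank ℝ E + 1 := by
      rw [← hz.affineSpan_eq_top_iff_card_eq_finrank_add_one]
      by_contra hne
      refine hx (Set.mem_biUnion (show Set.range z ∈ _ from ⟨hzS, hne⟩) ?_)
      refine convexHull_subset_affineSpan _ ?_
      rw [← hcx]
      exact (convex_convexHull ℝ _).sum_mem (fun i _ => (hc i).le) hc1
        fun i _ => subset_convexHull ℝ _ ⟨i, rfl⟩
    have : Nonempty ι := Fintype.card_pos_iff.1 (by omega)
    obtain ⟨k, -, hk⟩ := Finset.exists_max_image Finset.univ c Finset.univ_nonempty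
    have hcard' : Fintype.card (Fin n) = Fintype.card {i // i ≠ k} := by
      rw [Fintype.card_fin, Fintype.card_subtype_compl, Fintype.card_subtype_eq, hcard, hE]
      rfl
    let e : Fin n ≃ {i // i ≠ k} := Fintype.equivOfCardEq hcard'
    have hli : LinearIndependent ℝ fun i : Fin n => z (e i) - z k :=
      ((affineIndependent_iff_linearIndependent_vsub ℝ z k).1 hz).comp e e.injective
    have : Nonempty (Fin n) := ⟨⟨0, hn⟩⟩
    let w : Basis (Fin n) ℝ E :=
      basisOfLinearIndependentOfCardEqFinrank hli (by rw [Fintype.card_fin, hE])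
    have hw : ∀ i, w i = z (e i) - z k := fun i => by
      simp [w, coe_basisOfLinearIndependentOfCardEqFinrank]
    have hsum : ∑ j, c (e j) = 1 - c k := by
      rw [Fintype.sum_eq_add_sum_subtype_ne c k] at hc1
      rw [e.sum_comp fun j => c j]
      linarith
    refine ⟨(z k, w), ⟨hzS ⟨k, rfl⟩, fun i => ?_⟩, fun i => c (e i), fun i => hc _, fun i => ?_, ?_⟩
    · simp only [hw, add_sub_cancel]
      exact hzS ⟨_, rfl⟩
    · rw [hsum, sub_sub_cancel]
      exact hk _ (Finset.mem_univ _)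
    · simp only [hw, smul_sub, Finset.sum_sub_distrib, ← Finset.sum_smul, hsum]
      rw [e.sum_comp fun j => c j • z j, ← hcx,
        Fintype.sum_eq_add_sum_subtype_ne (fun i => c i • z i) k]
      module

/-- On the piece of a simplex where the barycentric coordinate of the vertex `k` is the largest,
a box with side lengths comparable to the other coordinates `c i` fits into the simplex. -/
theorem exists_boundaryEnvelope_mul_prod_le {n : ℕ} (k : E) (w : Basis (Fin n) ℝ E)
    {P : Set E} (hP : IsPolytope P) (hk : k ∈ P) (hw : ∀ i, k + w i ∈ P) {σ : Measure E}
    (hσ : IsFlatBoundaryMeasure P σ) :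
    ∃ K : ℝ≥0, ∀ c : Fin n → ℝ, (∀ i, 0 < c i) → (∀ i, c i ≤ 1 - ∑ j, c j) → ∀ m,
      boundaryEnvelope P σ (k + ∑ i, c i • w i) * ∏ i, ENNReal.ofReal (c i / n)
        ≤ K * ENNReal.ofReal (c m / n) := by
  obtain ⟨K, hK⟩ := exists_mul_prod_le w hP hσ
  refine ⟨K, fun c hc hc1 m => ?_⟩
  have hn : (1 : ℝ) ≤ n := by exact_mod_cast Nat.one_le_iff_ne_zero.2 (Fin.pos m).ne'
  have hn0 : (0 : ℝ) < n := by linarith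
  rw [boundaryEnvelope, ENNReal.iSup_mul]
  refine iSup_le fun u => hK _ (fun i => c i / n) (fun i => div_pos (hc i) hn0) (fun s hs => ?_)
    u.1 u.2.1 u.2.2.1 u.2.2.2 m
  rw [add_assoc, ← Finset.sum_add_distrib]
  simp only [← add_smul]
  refine hP.convex.add_sum_smul_mem hk hw (fun i => ?_) ?_
  · have h1 := (abs_le.1 (hs i)).1
    have h2 : c i / n ≤ c i := div_le_self (hc i).le hn
    linarith
  · rw [Finset.sum_add_distrib]
    have h1 : ∑ i, s i ≤ ∑ _i : Fin n, (1 - ∑ j, c j) / n := Finset.sum_le_sum fun i _ =>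
      ((abs_le.1 (hs i)).2).trans (div_le_div_of_nonneg_right (hc1 i) hn0.le)
    rw [Finset.sum_const, Finset.card_univ, Fintype.card_fin, nsmul_eq_mul,
      mul_div_cancel₀ _ hn0.ne'] at h1
    linarith

theorem exists_boundaryEnvelope_rpow_le {n : ℕ} (hn : 1 ≤ n) (k : E) (w : Basis (Fin n) ℝ E)
    {P : Set E} (hP : IsPolytope P) (hk : k ∈ P) (hw : ∀ i, k + w i ∈ P) {σ : Measure E}
    (hσ : IsFlatBoundaryMeasure P σ) {q : ℝ} (hq : 0 < q) (hqn : q * (n - 1) < n)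
    (ν : Measure E) [ν.IsAddHaarMeasure] :
    ∃ h : E → ℝ≥0∞, Measurable h ∧ ∫⁻ x, h x ∂ν < ∞ ∧
      ∀ c : Fin n → ℝ, (∀ i, 0 < c i) → (∀ i, c i ≤ 1 - ∑ j, c j) →
        boundaryEnvelope P σ (k + ∑ i, c i • w i) ^ q ≤ h (k + ∑ i, c i • w i) := by
  obtain ⟨K, hK⟩ := exists_boundaryEnvelope_mul_prod_le k w hP hk hw hσ
  have hn1 : (1 : ℝ) ≤ n := by exact_mod_cast hn
  have hn0 : (0 : ℝ) < n := by linarith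
  set θ : ℝ := q - q / n with hθ
  have hθ1 : θ < 1 := by
    have : θ = q * (n - 1) / n := by rw [hθ]; field_simp
    rw [this, div_lt_one hn0]
    exact hqn
  let φ : E ≃L[ℝ] (Fin n → ℝ) := w.equivFun.toContinuousLinearEquiv
  let ρ : Measure E := (volume : Measure (Fin n → ℝ)).map φ.symm
  have hρ : ρ.IsAddHaarMeasure := φ.symm.isAddHaarMeasure_map _
  obtain ⟨c₀, hν⟩ : ∃ c : ℝ≥0, ν = c • ρ := ⟨_, Measure.isAddLeftInvariant_eq_smul ν ρ⟩
  let f : ℝ → ℝ := (Set.Ioc 0 1).indicator fun t => (t / n) ^ (-θ)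
  have hf : Measurable f := Measurable.indicator (by fun_prop) measurableSet_Ioc
  have hfint : Integrable f volume := by
    refine (integrable_indicator_iff measurableSet_Ioc).2 ?_
    have h1 : IntegrableOn (fun t : ℝ => t ^ (-θ)) (Set.Ioc 0 1) volume :=
      (intervalIntegrable_iff_integrableOn_Ioc_of_le zero_le_one).1
        (intervalIntegral.intervalIntegrable_rpow' (by linarith))
    refine IntegrableOn.congr_fun (h1.div_const ((n : ℝ) ^ (-θ))) (fun t ht => ?_) measurableSet_Ioc
    exact (Real.div_rpow ht.1.le hn0.le _).symm
  let F : (Fin n → ℝ) → ℝ := fun y => ∏ i, f (y i)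
  have hF : Measurable F := Finset.measurable_fun_prod _ fun i _ => hf.comp (measurable_pi_apply i)
  have hFint : ∫⁻ y, ENNReal.ofReal (F y) < ∞ := by
    have : Integrable F (Measure.pi fun _ : Fin n => (volume : Measure ℝ)) :=
      Integrable.fintype_prod fun _ => hfint
    exact this.lintegral_lt_top
  have hg : Measurable fun x => ENNReal.ofReal (F (φ x)) :=
    (hF.comp φ.continuous.measurable).ennreal_ofReal
  have hgk : Measurable fun x => ENNReal.ofReal (F (φ (x - k))) :=
    hg.comp (measurable_sub_const k)
  refine ⟨fun x => (K : ℝ≥0∞) ^ q * ENNReal.ofReal (F (φ (x - k))), hgk.const_mul _, ?_,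
    fun c hc hc1 => ?_⟩
  · have h1 : ∫⁻ x, ENNReal.ofReal (F (φ (x - k))) ∂ν = ∫⁻ x, ENNReal.ofReal (F (φ x)) ∂ν :=
      lintegral_sub_right_eq_self (fun x => ENNReal.ofReal (F (φ x))) k
    rw [lintegral_const_mul _ hgk, h1, hν, lintegral_smul_measure,
      ENNReal.smul_def, smul_eq_mul, lintegral_map hg φ.symm.continuous.measurable]
    simp only [ContinuousLinearEquiv.apply_symm_apply]
    exact ENNReal.mul_lt_top (ENNReal.rpow_lt_top_of_nonneg hq.le ENNReal.coe_ne_top)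
      (ENNReal.mul_lt_top ENNReal.coe_lt_top hFint)
  · set x := k + ∑ i, c i • w i with hx
    have hφx : φ (x - k) = c := by
      rw [hx, add_sub_cancel_left]
      exact (congrArg w.equivFun (w.equivFun_symm_apply c).symm).trans
        (w.equivFun.apply_symm_apply c)
    have hpos : ∀ i, 0 < c i / n := fun i => div_pos (hc i) hn0
    have hle : ∀ i, c i ≤ 1 := fun i => (hc1 i).trans <| by
      have := Finset.sum_nonneg fun j (_ : j ∈ Finset.univ) => (hc j).le
      linarith
    have hFc : F (φ (x - k)) = ∏ i, (c i / n) ^ (-θ) := by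
      rw [hφx]
      exact Finset.prod_congr rfl fun i _ =>
        Set.indicator_of_mem (show c i ∈ Set.Ioc 0 1 from ⟨hc i, hle i⟩) _
    set U := boundaryEnvelope P σ x with hU
    set D := ∏ i, ENNReal.ofReal (c i / n) with hD
    have hD0 : D ≠ 0 := Finset.prod_ne_zero_iff.2 fun i _ => by simpa using hpos i
    have hDtop : D ≠ ∞ := ENNReal.prod_ne_top fun _ _ => ENNReal.ofReal_ne_top
    have hFD : ENNReal.ofReal (F (φ (x - k))) = D ^ (-θ) := by
      rw [hFc, ENNReal.ofReal_prod_of_nonneg fun i _ => (Real.rpow_pos_of_pos (hpos i) _).le, hD,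
        ← ENNReal.prod_rpow_of_ne_top fun _ _ => ENNReal.ofReal_ne_top]
      exact Finset.prod_congr rfl fun i _ => (ENNReal.ofReal_rpow_of_pos (hpos i)).symm
    -- the product over all directions of the bounds for the single directions
    have hprod : (U * D) ^ n ≤ K ^ n * D := by
      have := Finset.prod_le_prod' fun m (_ : m ∈ (Finset.univ : Finset (Fin n))) => hK c hc hc1 m
      rwa [Finset.prod_const, Finset.prod_mul_distrib, Finset.prod_const, Finset.card_univ,
        Fintype.card_fin] at this
    have hroot : U ^ q * D ^ q ≤ K ^ q * D ^ (q / n) := by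
      have h1 := ENNReal.rpow_le_rpow hprod (div_nonneg hq.le hn0.le)
      rwa [ENNReal.mul_rpow_of_nonneg _ _ (div_nonneg hq.le hn0.le), ← ENNReal.rpow_natCast,
        ← ENNReal.rpow_natCast, ← ENNReal.rpow_mul, ← ENNReal.rpow_mul, mul_div_cancel₀ _ hn0.ne',
        ENNReal.mul_rpow_of_nonneg _ _ hq.le] at h1
    change U ^ q ≤ (K : ℝ≥0∞) ^ q * ENNReal.ofReal (F (φ (x - k)))
    calc U ^ q = U ^ q * D ^ q * D ^ (-q) := by
          rw [mul_assoc, ← ENNReal.rpow_add _ _ hD0 hDtop, add_neg_cancel, ENNReal.rpow_zero,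
            mul_one]
      _ ≤ K ^ q * D ^ (q / n) * D ^ (-q) := by gcongr
      _ = K ^ q * ENNReal.ofReal (F (φ (x - k))) := by
          rw [mul_assoc, ← ENNReal.rpow_add _ _ hD0 hDtop, hFD, hθ]
          congr 2
          ring

theorem lintegral_boundaryEnvelope_rpow_lt_top {n : ℕ} (hn : 1 ≤ n) (hE : finrank ℝ E = n)
    {P : Set E} (hP : IsPolytope P) {σ : Measure E} (hσ : IsFlatBoundaryMeasure P σ) {q : ℝ}
    (hq : 0 < q) (hqn : q * (n - 1) < n) (ν : Measure E) [ν.IsAddHaarMeasure] :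
    ∫⁻ x in P, boundaryEnvelope P σ x ^ q ∂ν < ∞ := by
  obtain ⟨T, hT, hTP, hcover⟩ := hP.exists_finite_cover hn hE ν
  have key : ∀ t ∈ T, ∃ h : E → ℝ≥0∞, Measurable h ∧ ∫⁻ x, h x ∂ν < ∞ ∧
      ∀ c : Fin n → ℝ, (∀ i, 0 < c i) → (∀ i, c i ≤ 1 - ∑ j, c j) →
        boundaryEnvelope P σ (t.1 + ∑ i, c i • t.2 i) ^ q ≤ h (t.1 + ∑ i, c i • t.2 i) :=
    fun t ht => exists_boundaryEnvelope_rpow_le hn t.1 t.2 hP (hTP t ht).1 (hTP t ht).2 hσ hq hqn ν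
  choose! h hm hint hle using key
  have hTm : ∀ t ∈ hT.toFinset, Measurable (h t) := fun t ht => hm t (hT.mem_toFinset.1 ht)
  calc ∫⁻ x in P, boundaryEnvelope P σ x ^ q ∂ν
      ≤ ∫⁻ x in P, ∑ t ∈ hT.toFinset, h t x ∂ν := by
        refine lintegral_mono_ae ?_
        filter_upwards [hcover] with x hx
        obtain ⟨t, ht, c, hc, hc1, rfl⟩ := hx
        exact (hle t ht c hc hc1).trans (Finset.single_le_sum
          (f := fun t' => h t' (t.1 + ∑ i, c i • t.2 i)) (fun _ _ => zero_le)
          (hT.mem_toFinset.2 ht))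
    _ ≤ ∫⁻ x, ∑ t ∈ hT.toFinset, h t x ∂ν := setLIntegral_le_lintegral _ _
    _ = ∑ t ∈ hT.toFinset, ∫⁻ x, h t x ∂ν := lintegral_finsetSum _ hTm
    _ < ∞ := ENNReal.sum_lt_top.2 fun t ht => hint t (hT.mem_toFinset.1 ht)

theorem boundaryEnvelope_ae_bounded_of_finrank_eq_one (hE : finrank ℝ E = 1) {P : Set E}
    (hP : IsPolytope P) {σ : Measure E} (hσ : IsFlatBoundaryMeasure P σ) (ν : Measure E)
    [ν.IsAddHaarMeasure] : ∃ K : ℝ≥0, ∀ᵐ x ∂ν.restrict P, boundaryEnvelope P σ x ≤ K := by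
  obtain ⟨T, hT, hTP, hcover⟩ := hP.exists_finite_cover le_rfl hE ν
  have key : ∀ t ∈ T, ∃ K : ℝ≥0, ∀ c : Fin 1 → ℝ, (∀ i, 0 < c i) → (∀ i, c i ≤ 1 - ∑ j, c j) →
      boundaryEnvelope P σ (t.1 + ∑ i, c i • t.2 i) ≤ K := by
    intro t ht
    obtain ⟨K, hK⟩ := exists_boundaryEnvelope_mul_prod_le t.1 t.2 hP (hTP t ht).1 (hTP t ht).2 hσ
    refine ⟨K, fun c hc hc1 => ?_⟩
    have h := hK c hc hc1 0
    rw [Fin.prod_univ_one] at h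
    exact (ENNReal.mul_le_mul_iff_left (by simpa using hc 0) ENNReal.ofReal_ne_top).1 h
  choose! K hK using key
  refine ⟨∑ t ∈ hT.toFinset, K t, ?_⟩
  filter_upwards [hcover] with x hx
  obtain ⟨t, ht, c, hc, hc1, rfl⟩ := hx
  refine (hK t ht c hc hc1).trans ?_
  exact_mod_cast Finset.single_le_sum (f := K) (fun _ _ => zero_le) (hT.mem_toFinset.2 ht)

theorem boundaryEnvelope_ne_top (hE : 1 ≤ finrank ℝ E) {P : Set E} (hP : IsPolytope P)
    {σ : Measure E} (hσ : IsFlatBoundaryMeasure P σ) :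
    ∀ x ∈ interior P, boundaryEnvelope P σ x ≠ ∞ := by
  let ν : Measure E := Measure.addHaar
  have h := lintegral_boundaryEnvelope_rpow_lt_top hE rfl hP hσ one_pos (by linarith) ν
  simp only [ENNReal.rpow_one] at h
  exact (isConvexFun_boundaryEnvelope P σ).ne_top_of_ae hP (ν := ν)
    ((ae_lt_top' (aemeasurable_of_lowerSemicontinuousOn hP.isClosed
      (lowerSemicontinuousOn_boundaryEnvelope P σ) ν) h.ne).mono fun x hx => hx.ne)

/-- The scaling argument: every lower semicontinuous convex function is at most its boundary
integral times the envelope. If the boundary integral vanishes, all multiples of the function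
are below the envelope, so it vanishes where the envelope is finite. -/
theorem IsConvexFun.le_lintegral_mul_boundaryEnvelope (hE : 1 ≤ finrank ℝ E) {P : Set E}
    (hP : IsPolytope P) {σ : Measure E} (hσ : IsFlatBoundaryMeasure P σ) {u : E → ℝ≥0∞}
    (hu : LowerSemicontinuousOn u P) (hconv : IsConvexFun P u) {x : E} (hx : x ∈ P) :
    u x ≤ (∫⁻ y in frontier P, u y ∂σ) * boundaryEnvelope P σ x := by
  set J := ∫⁻ y in frontier P, u y ∂σ with hJ
  rcases eq_or_ne J ∞ with h | htop
  · rw [h, ENNReal.top_mul (boundaryEnvelope_pos (hσ.measure_frontier_lt_top hP).ne x).ne']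
    exact le_top
  have hmeas : AEMeasurable u (σ.restrict (frontier P)) :=
    aemeasurable_of_lowerSemicontinuousOn isClosed_frontier
      (hu.mono hP.isClosed.frontier_subset) σ
  have hscale : ∀ c : ℝ≥0∞, c ≠ ∞ → c * J ≤ 1 → ∀ y, c * u y ≤ boundaryEnvelope P σ y := by
    intro c hc hcJ y
    refine le_boundaryEnvelope (u := fun y => c * u y) ?_ (hconv.const_mul c) ?_ y
    · intro z hz b hb
      rcases eq_or_ne c 0 with rfl | hc0
      · simp at hb
      have hb' : b / c < u z := ENNReal.div_lt_of_lt_mul' hb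
      filter_upwards [hu z hz _ hb'] with z' hz'
      rwa [gt_iff_lt, ENNReal.div_lt_iff (Or.inl hc0) (Or.inl hc), mul_comm] at hz'
    · rwa [lintegral_const_mul'' _ hmeas]
  rcases eq_or_ne J 0 with h0 | h0
  · rw [h0, zero_mul]
    obtain ⟨p, hp⟩ := hP.nonempty_interior
    refine le_of_le_on_interior hP.convex hu (isConvexFun_const P 0) hp ENNReal.zero_ne_top ?_ x hx
    intro y hy
    by_contra! hpos
    refine boundaryEnvelope_ne_top hE hP hσ y hy ?_
    rw [← top_le_iff]
    refine ENNReal.le_of_forall_nnreal_lt fun r _ => ?_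
    rcases eq_or_ne (u y) ∞ with hy' | hy'
    · have := hscale 1 ENNReal.one_ne_top (by rw [h0]; simp) y
      rw [hy', one_mul, top_le_iff] at this
      rw [this]; exact le_top
    · have := hscale (r / u y) (ENNReal.div_ne_top ENNReal.coe_ne_top hpos.ne')
        (by rw [h0]; simp) y
      rwa [ENNReal.div_mul_cancel hpos.ne' hy'] at this
  · have h := hscale J⁻¹ (ENNReal.inv_ne_top.2 h0) (ENNReal.inv_mul_cancel h0 htop).le x
    calc u x = J * (J⁻¹ * u x) := by
          rw [← mul_assoc, ENNReal.mul_inv_cancel h0 htop, one_mul]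
      _ ≤ _ := by gcongr

end

/-! ### Locally uniform convergence of convex functions -/

/-- Convex functions on an open set that are locally bounded, uniformly in the sequence, and that
converge on a dense set converge locally uniformly: they are locally equi-Lipschitz. -/
theorem exists_tendstoLocallyUniformlyOn_of_convexOn {O D : Set E} (hO : IsOpen O)
    (hD : Dense D) {f : ℕ → E → ℝ} (hf : ∀ i, ConvexOn ℝ O (f i)) {M : E → ℝ}
    (hM : ContinuousOn M O) (hbound : ∀ i, ∀ x ∈ O, |f i x| ≤ M x)
    (hconv : ∀ d ∈ D, d ∈ O → ∃ l, Tendsto (fun i => f i d) atTop (𝓝 l)) :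
    ∃ g : E → ℝ, TendstoLocallyUniformlyOn f g atTop O := by
  have hlip : ∀ x ∈ O, ∃ r > 0, ∃ K : ℝ, 0 < K ∧ Metric.ball x r ⊆ O ∧
      ∀ i, ∀ y ∈ Metric.ball x r, ∀ z ∈ Metric.ball x r, |f i y - f i z| ≤ K * dist y z := by
    intro x hx
    have h1 : ∀ᶠ y in 𝓝 x, y ∈ O ∧ M y < M x + 1 := (hO.eventually_mem hx).and
      ((hM.continuousAt (hO.mem_nhds hx)).eventually (gt_mem_nhds (lt_add_one _)))
    obtain ⟨r, hr, hball⟩ := Metric.eventually_nhds_iff_ball.1 h1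
    have hM0 : 0 ≤ M x := (abs_nonneg _).trans (hbound 0 x hx)
    have hsub : Metric.ball x (r - r / 2) ⊆ O := fun y hy =>
      (hball y (Metric.ball_subset_ball (by linarith) hy)).1
    refine ⟨r - r / 2, by linarith, 2 * (M x + 1) / (r / 2), by positivity, hsub,
      fun i y hy z hz => ?_⟩
    have hcv : ConvexOn ℝ (Metric.ball x r) (f i) :=
      (hf i).subset (fun y hy => (hball y hy).1) (convex_ball x r)
    have hL := hcv.lipschitzOnWith_of_abs_le (half_pos hr) (M := M x + 1) fun a ha =>
      (hbound i a (hball a ha).1).trans (hball a ha).2.le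
    have := hL.dist_le_mul y hy z hz
    rwa [Real.dist_eq, Real.coe_toNNReal _ (by positivity)] at this
  have hlim : ∀ x ∈ O, ∃ l, Tendsto (fun i => f i x) atTop (𝓝 l) := by
    intro x hx
    obtain ⟨r, hr, K, hK, hsub, hL⟩ := hlip x hx
    refine cauchySeq_tendsto_of_complete (Metric.cauchySeq_iff.2 fun ε hε => ?_)
    obtain ⟨d, hd, hdx⟩ := hD.exists_dist_lt x (lt_min hr (div_pos hε (mul_pos three_pos hK)))
    have hdr : d ∈ Metric.ball x r := by
      rw [Metric.mem_ball, dist_comm]; exact hdx.trans_le (min_le_left _ _)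
    obtain ⟨l, hl⟩ := hconv d hd (hsub hdr)
    obtain ⟨N, hN⟩ := Metric.cauchySeq_iff.1 hl.cauchySeq (ε / 3) (by linarith)
    refine ⟨N, fun m hm k hk => ?_⟩
    have h1 := hL m x (Metric.mem_ball_self hr) d hdr
    have h2 := hL k x (Metric.mem_ball_self hr) d hdr
    have h3 := hN m hm k hk
    have h4 : K * dist x d < ε / 3 := by
      have := mul_lt_mul_of_pos_left (hdx.trans_le (min_le_right _ _)) hK
      refine this.trans_eq ?_
      field_simp
    rw [Real.dist_eq] at h3 ⊢
    rw [abs_le] at h1 h2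
    rw [abs_lt] at h3 ⊢
    constructor <;> linarith [h1.1, h1.2, h2.1, h2.2, h3.1, h3.2]
  choose! g hg using hlim
  refine ⟨g, Metric.tendstoLocallyUniformlyOn_iff.2 fun ε hε x hx => ?_⟩
  obtain ⟨r, hr, K, hK, hsub, hL⟩ := hlip x hx
  have hδ : 0 < min r (ε / (3 * K)) := lt_min hr (by positivity)
  refine ⟨Metric.ball x (min r (ε / (3 * K))), mem_nhdsWithin_of_mem_nhds (Metric.ball_mem_nhds _ hδ),
    ?_⟩
  filter_upwards [Metric.tendsto_nhds.1 (hg x hx) (ε / 3) (by linarith)] with i hi y hy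
  have hyr : y ∈ Metric.ball x r := Metric.ball_subset_ball (min_le_left _ _) hy
  have hKy : K * dist y x < ε / 3 := by
    have := mul_lt_mul_of_pos_left ((Metric.mem_ball.1 hy).trans_le (min_le_right _ _)) hK
    refine this.trans_eq ?_
    field_simp
  have h1 := hL i y hyr x (Metric.mem_ball_self hr)
  have h2 : |g y - g x| ≤ K * dist y x :=
    le_of_tendsto ((hg y (hsub hyr)).sub (hg x hx)).abs
      (Eventually.of_forall fun j => hL j y hyr x (Metric.mem_ball_self hr))
  rw [Real.dist_eq] at hi ⊢
  rw [abs_le] at h1 h2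
  rw [abs_lt] at hi ⊢
  constructor <;> linarith [h1.1, h1.2, h2.1, h2.2, hi.1, hi.2]

/-- Bounded sequences of convex functions have subsequences that converge locally uniformly: a
diagonal sequence converges on a countable dense set. -/
theorem exists_subseq_tendstoLocallyUniformlyOn [SecondCountableTopology E] {P : Set E}
    (hP : Convex ℝ P) {u : ℕ → E → ℝ≥0∞} (hu : ∀ i, IsConvexFun P (u i)) {M : E → ℝ≥0∞}
    (hM : ContinuousOn M (interior P)) (hMtop : ∀ x ∈ interior P, M x ≠ ∞)
    (hbound : ∀ i, ∀ x ∈ interior P, u i x ≤ M x) :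
    ∃ φ : ℕ → ℕ, StrictMono φ ∧ ∃ g : E → ℝ,
      TendstoLocallyUniformlyOn (fun i x => (u (φ i) x).toReal) g atTop (interior P) := by
  obtain ⟨D, hDc, hD⟩ := TopologicalSpace.exists_countable_dense E
  have : Countable D := hDc.to_subtype
  obtain ⟨a, φ, hφ, ha⟩ := CompactSpace.tendsto_subseq fun i (d : D) => u i d
  refine ⟨φ, hφ, exists_tendstoLocallyUniformlyOn_of_convexOn isOpen_interior hD
    (fun i => (hu (φ i)).convexOn_toReal hP fun x hx => ?_) (M := fun x => (M x).toReal)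
    (fun x hx => (ENNReal.tendsto_toReal (hMtop x hx)).comp (hM x hx))
    (fun i x hx => ?_) (fun d hd hdO => ?_)⟩
  · exact ne_top_of_le_ne_top (hMtop x hx) (hbound _ x hx)
  · rw [abs_of_nonneg ENNReal.toReal_nonneg]
    exact ENNReal.toReal_mono (hMtop x hx) (hbound _ x hx)
  · have hd' : Tendsto (fun i => u (φ i) d) atTop (𝓝 (a ⟨d, hd⟩)) := tendsto_pi_nhds.1 ha ⟨d, hd⟩
    have hle : a ⟨d, hd⟩ ≤ M d := le_of_tendsto' hd' fun i => hbound _ d hdO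
    exact ⟨_, (ENNReal.tendsto_toReal (ne_top_of_le_ne_top (hMtop d hdO) hle)).comp hd'⟩

/-! ### Integrability and compactness on polytopes -/

theorem natCast_div_sub_one_toReal {n : ℕ} (hn : 1 ≤ n) :
    ((n : ℝ≥0∞) / ((n : ℝ≥0∞) - 1)).toReal = (n : ℝ) / (n - 1) := by
  rw [ENNReal.toReal_div, ENNReal.toReal_sub_of_le (by exact_mod_cast hn) (by simp)]
  simp

theorem ne_top_and_toReal_mul_lt {n : ℕ} (hn : 1 ≤ n) {q : ℝ≥0∞}
    (hq : q < (n : ℝ≥0∞) / ((n : ℝ≥0∞) - 1)) : q ≠ ∞ ∧ q.toReal * (n - 1) < n := by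
  have htop : q ≠ ∞ := (hq.trans_le le_top).ne
  refine ⟨htop, ?_⟩
  rcases hn.eq_or_lt with rfl | hn1
  · simp
  · have hn' : (1 : ℝ) < n := by exact_mod_cast hn1
    have hne : (n : ℝ≥0∞) - 1 ≠ 0 := by
      rw [Ne, tsub_eq_zero_iff_le, not_le]; exact_mod_cast hn1
    have h := (ENNReal.toReal_lt_toReal htop (ENNReal.div_ne_top (by simp) hne)).2 hq
    rwa [natCast_div_sub_one_toReal hn, lt_div_iff₀ (by linarith)] at h

theorem memLp_natCast_div_sub_one {α : Type*} [MeasurableSpace α] {n : ℕ} (hn : 1 ≤ n)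
    {μ : Measure α} {f : α → ℝ≥0∞}
    (hf : AEMeasurable f μ) (h1 : n = 1 → ∃ K : ℝ≥0, ∀ᵐ x ∂μ, f x ≤ K)
    (h2 : 1 < n → ∫⁻ x, f x ^ ((n : ℝ) / (n - 1)) ∂μ < ∞) :
    MemLp f ((n : ℝ≥0∞) / ((n : ℝ≥0∞) - 1)) μ := by
  refine ⟨hf.aestronglyMeasurable, ?_⟩
  rcases hn.eq_or_lt with h | hn1
  · obtain ⟨K, hK⟩ := h1 h.symm
    subst h
    have : ((1 : ℕ) : ℝ≥0∞) / (((1 : ℕ) : ℝ≥0∞) - 1) = ∞ := by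
      rw [Nat.cast_one, tsub_self, ENNReal.div_zero one_ne_zero]
    rw [this, eLpNorm_exponent_top]
    exact eLpNormEssSup_lt_top_of_ae_enorm_bound (hK.mono fun x hx => by rwa [enorm_eq_self])
  · have hne : (n : ℝ≥0∞) - 1 ≠ 0 := by
      rw [Ne, tsub_eq_zero_iff_le, not_le]; exact_mod_cast hn1
    have h0 : (n : ℝ≥0∞) / ((n : ℝ≥0∞) - 1) ≠ 0 :=
      ENNReal.div_ne_zero.2 ⟨by simp; omega, ne_top_of_le_ne_top (by simp) tsub_le_self⟩
    rw [eLpNorm_lt_top_iff_lintegral_rpow_enorm_lt_top h0 (ENNReal.div_ne_top (by simp) hne),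
      natCast_div_sub_one_toReal hn]
    simpa only [enorm_eq_self] using h2 hn1

section

variable [FiniteDimensional ℝ E] [MeasurableSpace E] [BorelSpace E]

theorem IsPolytope.ae_mem_interior {P : Set E} (hP : IsPolytope P) (ν : Measure E)
    [ν.IsAddHaarMeasure] : ∀ᵐ x ∂ν.restrict P, x ∈ interior P := by
  rw [ae_restrict_iff' hP.isClosed.measurableSet]
  filter_upwards [measure_eq_zero_iff_ae_notMem.1 (hP.convex.addHaar_frontier ν)] with x hx hxP
  by_contra h
  exact hx ⟨subset_closure hxP, h⟩

/-- A convex function with finite boundary integral is finite on the interior, where it agrees with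
its lower semicontinuous hull and is bounded by the envelope. -/
theorem IsConvexFun.interior_bounds (hE : 1 ≤ finrank ℝ E) {P : Set E} (hP : IsPolytope P)
    {σ : Measure E} (hσ : IsFlatBoundaryMeasure P σ) {u : E → ℝ≥0∞} (hu : IsConvexFun P u)
    {C : ℝ≥0} (hC : ∫⁻ y in frontier P, u y ∂σ ≤ C) :
    (∫⁻ y in frontier P, FlatPolytope.lscHull P u y ∂σ ≤ C) ∧
      ∀ x ∈ interior P, u x ≠ ∞ ∧ FlatPolytope.lscHull P u x = u x ∧
        u x ≤ C * boundaryEnvelope P σ x := by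
  have hint : ∫⁻ y in frontier P, FlatPolytope.lscHull P u y ∂σ ≤ C :=
    (setLIntegral_mono' isClosed_frontier.measurableSet fun y hy =>
      lscHull_le u (hP.isClosed.frontier_subset hy)).trans hC
  have hle : ∀ x ∈ interior P, FlatPolytope.lscHull P u x ≤ C * boundaryEnvelope P σ x :=
    fun x hx => ((hu.lscHull hP.convex).le_lintegral_mul_boundaryEnvelope hE hP hσ
      (lowerSemicontinuousOn_lscHull P u) (interior_subset hx)).trans (by gcongr)
  have hfin : ∀ x ∈ interior P, u x ≠ ∞ := hu.ne_top_of_lscHull_ne_top hP.convex fun x hx =>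
    ne_top_of_le_ne_top (ENNReal.mul_ne_top ENNReal.coe_ne_top
      (boundaryEnvelope_ne_top hE hP hσ x hx)) (hle x hx)
  refine ⟨hint, fun x hx => ⟨hfin x hx, hu.lscHull_eq hP.convex hfin hx, ?_⟩⟩
  rw [← hu.lscHull_eq hP.convex hfin hx]
  exact hle x hx

theorem IsConvexFun.aemeasurable {P : Set E} (hP : IsPolytope P) {u : E → ℝ≥0∞}
    (hu : IsConvexFun P u) (hfin : ∀ x ∈ interior P, u x ≠ ∞) (ν : Measure E)
    [ν.IsAddHaarMeasure] : AEMeasurable u (ν.restrict P) :=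
  (aemeasurable_of_lowerSemicontinuousOn hP.isClosed (lowerSemicontinuousOn_lscHull P u) ν).congr
    ((hP.ae_mem_interior ν).mono fun _ hx => hu.lscHull_eq hP.convex hfin hx)

theorem memLp_boundaryEnvelope {n : ℕ} (hn : 1 ≤ n) (hE : finrank ℝ E = n) {P : Set E}
    (hP : IsPolytope P) {σ : Measure E} (hσ : IsFlatBoundaryMeasure P σ) (ν : Measure E)
    [ν.IsAddHaarMeasure] {q : ℝ≥0∞} (hq : q < (n : ℝ≥0∞) / ((n : ℝ≥0∞) - 1)) :
    MemLp (boundaryEnvelope P σ) q (ν.restrict P) := by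
  have hm := (aemeasurable_of_lowerSemicontinuousOn hP.isClosed
    (lowerSemicontinuousOn_boundaryEnvelope P σ) ν).aestronglyMeasurable
  rcases eq_or_ne q 0 with rfl | h0
  · exact memLp_zero_iff_aestronglyMeasurable.2 hm
  obtain ⟨htop, hlt⟩ := ne_top_and_toReal_mul_lt hn hq
  refine ⟨hm, (eLpNorm_lt_top_iff_lintegral_rpow_enorm_lt_top h0 htop).2 ?_⟩
  simp only [enorm_eq_self]
  exact lintegral_boundaryEnvelope_rpow_lt_top hn hE hP hσ (ENNReal.toReal_pos h0 htop) hlt ν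

/-- Lower semicontinuous convex functions that agree almost everywhere on a polytope, one of them
being finite on the interior, agree on the whole polytope. -/
theorem eqOn_of_ae_eq {P : Set E} (hP : IsPolytope P) {v w : E → ℝ≥0∞}
    (hv : LowerSemicontinuousOn v P) (hvc : IsConvexFun P v) (hw : LowerSemicontinuousOn w P)
    (hwc : IsConvexFun P w) (hfin : ∀ x ∈ interior P, v x ≠ ∞) {ν : Measure E}
    [ν.IsAddHaarMeasure] (h : v =ᵐ[ν.restrict P] w) : Set.EqOn w v P := by
  have hwfin : ∀ x ∈ interior P, w x ≠ ∞ := hwc.ne_top_of_ae hP (ν := ν) <| by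
    filter_upwards [h, hP.ae_mem_interior ν] with x hx hxi
    rw [← hx]; exact hfin x hxi
  have heq : Set.EqOn v w (interior P) := Measure.eqOn_open_of_ae_eq
    (ae_restrict_of_ae_restrict_of_subset interior_subset h) isOpen_interior
    (fun x hx => (hvc.continuousAt hP.convex hfin hx).continuousWithinAt)
    (fun x hx => (hwc.continuousAt hP.convex hwfin hx).continuousWithinAt)
  obtain ⟨p, hp⟩ := hP.nonempty_interior
  exact fun x hx => le_antisymm
    (le_of_le_on_interior hP.convex hw hvc hp (hfin p hp) (fun y hy => (heq hy).ge) x hx)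
    (le_of_le_on_interior hP.convex hv hwc hp (hwfin p hp) (fun y hy => (heq hy).le) x hx)

/-- The compactness statement on the interior: a subsequence of convex functions with bounded
boundary integrals converges locally uniformly on the interior to a lower semicontinuous convex
function, the lower semicontinuous hull of the pointwise upper limit. -/
theorem exists_subseq_tendsto_interior (hE : 1 ≤ finrank ℝ E) {P : Set E} (hP : IsPolytope P)
    {σ : Measure E} (hσ : IsFlatBoundaryMeasure P σ) {u : ℕ → E → ℝ≥0∞}
    (hu : ∀ i, IsConvexFun P (u i)) {C : ℝ≥0} (hC : ∀ i, ∫⁻ y in frontier P, u i y ∂σ ≤ C) :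
    ∃ φ : ℕ → ℕ, StrictMono φ ∧ ∃ v : E → ℝ≥0∞, LowerSemicontinuousOn v P ∧ IsConvexFun P v ∧
      (∀ x ∈ interior P, v x ≤ C * boundaryEnvelope P σ x) ∧
      (∀ x ∈ interior P, Tendsto (fun i => u (φ i) x) atTop (𝓝 (v x))) ∧
      ∀ K : Set E, IsCompact K → K ⊆ interior P →
        TendstoUniformlyOn (fun i x => (u (φ i) x).toReal) (fun x => (v x).toReal) atTop K := by
  have hb := fun i => ((hu i).interior_bounds hE hP hσ (hC i)).2
  have hUtop := boundaryEnvelope_ne_top hE hP hσ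
  have hMtop : ∀ x ∈ interior P, C * boundaryEnvelope P σ x ≠ ∞ := fun x hx =>
    ENNReal.mul_ne_top ENNReal.coe_ne_top (hUtop x hx)
  have hMc : ContinuousOn (fun x => C * boundaryEnvelope P σ x) (interior P) := fun x hx =>
    (((isConvexFun_boundaryEnvelope P σ).const_mul C).continuousAt hP.convex hMtop
      hx).continuousWithinAt
  obtain ⟨φ, hφ, g, hg⟩ := exists_subseq_tendstoLocallyUniformlyOn hP.convex hu hMc hMtop
    fun i x hx => (hb i x hx).2.2
  let w : E → ℝ≥0∞ := fun x => limsup (fun i => u (φ i) x) atTop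
  have hwc : IsConvexFun P w := IsConvexFun.limsup fun i => hu (φ i)
  have hlim : ∀ x ∈ interior P, Tendsto (fun i => u (φ i) x) atTop (𝓝 (ENNReal.ofReal (g x))) := by
    intro x hx
    refine (ENNReal.tendsto_ofReal (hg.tendsto_at hx)).congr fun i => ?_
    exact ENNReal.ofReal_toReal (hb (φ i) x hx).1
  have hwg : ∀ x ∈ interior P, w x = ENNReal.ofReal (g x) := fun x hx => (hlim x hx).limsup_eq
  have hvw : ∀ x ∈ interior P, lscHull P w x = w x := fun x hx =>
    hwc.lscHull_eq hP.convex (fun y hy => by rw [hwg y hy]; exact ENNReal.ofReal_ne_top) hx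
  have hlimv : ∀ x ∈ interior P, Tendsto (fun i => u (φ i) x) atTop (𝓝 (lscHull P w x)) :=
    fun x hx => by rw [hvw x hx, hwg x hx]; exact hlim x hx
  refine ⟨φ, hφ, lscHull P w, lowerSemicontinuousOn_lscHull P w, hwc.lscHull hP.convex,
    fun x hx => le_of_tendsto' (hlimv x hx) fun i => (hb (φ i) x hx).2.2, hlimv, fun K hK hKP => ?_⟩
  have huni := (tendstoLocallyUniformlyOn_iff_forall_isCompact isOpen_interior).1 hg K hKP hK
  refine huni.congr_right fun x hx => ?_
  have h1 := (ENNReal.tendsto_toReal (by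
    rw [hvw x (hKP hx), hwg x (hKP hx)]; exact ENNReal.ofReal_ne_top)).comp (hlimv x (hKP hx))
  exact tendsto_nhds_unique (hg.tendsto_at (hKP hx)) h1

end

end FlatPolytope

open FlatPolytope in
theorem theorem2 {E : Type*} [NormedAddCommGroup E] [NormedSpace ℝ E] [FiniteDimensional ℝ E]
    [MeasurableSpace E] [BorelSpace E] (n : ℕ) (hn : 1 ≤ n) (hE : Module.finrank ℝ E = n)
    (P : Set E) (μ σ : Measure E) (hP : IsSystem P μ σ) :
    (∃ U : E → ℝ≥0∞, LowerSemicontinuousOn U P ∧ IsConvexFun P U ∧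
      (∀ q : ℝ≥0∞, q < (n : ℝ≥0∞) / ((n : ℝ≥0∞) - 1) → MemLp U q μ) ∧
      ∀ u : E → ℝ≥0∞, LowerSemicontinuousOn u P → IsConvexFun P u →
        ∀ x ∈ P, u x ≤ (∫⁻ y in frontier P, u y ∂σ) * U x) ∧
    (∀ (u : ℕ → E → ℝ≥0∞) (C : ℝ≥0), (∀ i, IsConvexFun P (u i)) →
      (∀ i, ∫⁻ y in frontier P, u i y ∂σ ≤ C) →
      (∀ i, MemLp (u i) ((n : ℝ≥0∞) / ((n : ℝ≥0∞) - 1)) μ) ∧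
      ∃ φ : ℕ → ℕ, StrictMono φ ∧ ∃ v : E → ℝ≥0∞,
        LowerSemicontinuousOn v P ∧ IsConvexFun P v ∧
        MemLp v ((n : ℝ≥0∞) / ((n : ℝ≥0∞) - 1)) μ ∧
        (∀ p : ℝ≥0∞, p < (n : ℝ≥0∞) / ((n : ℝ≥0∞) - 1) →
          TendstoInLp μ p (fun i => u (φ i)) v) ∧
        (∀ x ∈ interior P, v x ≠ ∞ ∧ ∀ i, u (φ i) x ≠ ∞) ∧
        (∀ K : Set E, IsCompact K → K ⊆ interior P →
          TendstoUniformlyOn (fun i x => (u (φ i) x).toReal) (fun x => (v x).toReal) atTop K) ∧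
        (∀ w : E → ℝ≥0∞, LowerSemicontinuousOn w P → IsConvexFun P w →
          ∀ p : ℝ≥0∞, p < (n : ℝ≥0∞) / ((n : ℝ≥0∞) - 1) →
            TendstoInLp μ p (fun i => u (φ i)) w → Set.EqOn w v P)) := by
  obtain ⟨hPol, -, ⟨ν, hν, rfl⟩, hσ⟩ := hP
  have hE1 : 1 ≤ finrank ℝ E := hE ▸ hn
  have hUtop := boundaryEnvelope_ne_top hE1 hPol hσ
  have hint := hPol.ae_mem_interior ν
  have hfinite : IsFiniteMeasure (ν.restrict P) :=
    isFiniteMeasure_restrict.2 hPol.isCompact.measure_ne_top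
  refine ⟨⟨boundaryEnvelope P σ, lowerSemicontinuousOn_boundaryEnvelope P σ,
    isConvexFun_boundaryEnvelope P σ, fun q hq => memLp_boundaryEnvelope hn hE hPol hσ ν hq,
    fun u hu hconv x hx => hconv.le_lintegral_mul_boundaryEnvelope hE1 hPol hσ hu hx⟩, ?_⟩
  intro u C hu hC
  have hb := fun i => ((hu i).interior_bounds hE1 hPol hσ (hC i)).2
  have hmeas : ∀ i, AEMeasurable (u i) (ν.restrict P) := fun i =>
    (hu i).aemeasurable hPol (fun x hx => (hb i x hx).1) ν
  have hbdd : ∀ f : E → ℝ≥0∞, (∀ x ∈ interior P, f x ≤ C * boundaryEnvelope P σ x) → n = 1 →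
      ∃ K : ℝ≥0, ∀ᵐ x ∂ν.restrict P, f x ≤ K := by
    rintro f hf rfl
    obtain ⟨K, hK⟩ := boundaryEnvelope_ae_bounded_of_finrank_eq_one hE hPol hσ ν
    refine ⟨C * K, ?_⟩
    filter_upwards [hK, hint] with x hx hxi
    rw [ENNReal.coe_mul]
    exact (hf x hxi).trans (by gcongr)
  have hpow : 1 < n → ∃ B : ℝ≥0, ∀ i, ∫⁻ x in P, u i x ^ ((n : ℝ) / (n - 1)) ∂ν ≤ B := by
    intro hn1
    have hn' : (1 : ℝ) < n := by exact_mod_cast hn1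
    have hp : 0 ≤ (n : ℝ) / (n - 1) := div_nonneg (by linarith) (by linarith)
    obtain ⟨K, hK⟩ := exists_lintegral_rpow_le ν hn1 hE hPol hσ
    refine ⟨K * C ^ ((n : ℝ) / (n - 1)), fun i => ?_⟩
    calc ∫⁻ x in P, u i x ^ ((n : ℝ) / (n - 1)) ∂ν
        = ∫⁻ x in P, lscHull P (u i) x ^ ((n : ℝ) / (n - 1)) ∂ν :=
          lintegral_congr_ae (hint.mono fun x hx => by
            simp only [(hb i x hx).2.1])
      _ ≤ K * (∫⁻ y in frontier P, lscHull P (u i) y ∂σ) ^ ((n : ℝ) / (n - 1)) :=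
          hK _ (lowerSemicontinuousOn_lscHull P _) ((hu i).lscHull hPol.convex)
      _ ≤ K * (C : ℝ≥0∞) ^ ((n : ℝ) / (n - 1)) := by
          gcongr
          exact ((hu i).interior_bounds hE1 hPol hσ (hC i)).1
      _ = _ := by rw [ENNReal.coe_mul, ENNReal.coe_rpow_of_nonneg _ hp]
  refine ⟨fun i => memLp_natCast_div_sub_one hn (hmeas i)
    (hbdd _ fun x hx => (hb i x hx).2.2) fun hn1 => ?_, ?_⟩
  · obtain ⟨B, hB⟩ := hpow hn1
    exact (hB i).trans_lt ENNReal.coe_lt_top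
  obtain ⟨φ, hφ, v, hv, hvc, hvU, hlim, huni⟩ := exists_subseq_tendsto_interior hE1 hPol hσ hu hC
  have hvm := aemeasurable_of_lowerSemicontinuousOn hPol.isClosed hv ν
  have hvtop : ∀ x ∈ interior P, v x ≠ ∞ := fun x hx =>
    ne_top_of_le_ne_top (ENNReal.mul_ne_top ENNReal.coe_ne_top (hUtop x hx)) (hvU x hx)
  have hLp : ∀ p : ℝ≥0∞, p < (n : ℝ≥0∞) / ((n : ℝ≥0∞) - 1) →
      TendstoInLp (ν.restrict P) p (fun i => u (φ i)) v := by
    intro p hp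
    obtain ⟨hptop, hpn⟩ := ne_top_and_toReal_mul_lt hn hp
    refine tendstoInLp_of_dominated (M := fun x => C * boundaryEnvelope P σ x)
      (fun i => hmeas (φ i)) hvm
      (hint.mono fun x hx => ENNReal.mul_ne_top ENNReal.coe_ne_top (hUtop x hx))
      (fun i => hint.mono fun x hx => (hb (φ i) x hx).2.2) (hint.mono hvU) (hint.mono hlim) hptop ?_
    simp only [ENNReal.mul_rpow_of_nonneg _ _ ENNReal.toReal_nonneg]
    rw [lintegral_const_mul' _ _ (ENNReal.rpow_ne_top_of_nonneg ENNReal.toReal_nonneg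
      ENNReal.coe_ne_top)]
    refine ENNReal.mul_lt_top (ENNReal.rpow_lt_top_of_nonneg ENNReal.toReal_nonneg
      ENNReal.coe_ne_top) ?_
    rcases eq_or_ne p 0 with rfl | h0
    · simp [lt_top_iff_ne_top, hPol.isCompact.measure_ne_top]
    · exact lintegral_boundaryEnvelope_rpow_lt_top hn hE hPol hσ (ENNReal.toReal_pos h0 hptop) hpn ν
  refine ⟨φ, hφ, v, hv, hvc, memLp_natCast_div_sub_one hn hvm (hbdd v hvU) fun hn1 => ?_, hLp,
    fun x hx => ⟨hvtop x hx, fun i => (hb (φ i) x hx).1⟩, huni, fun w hw hwc p hp h => ?_⟩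
  · -- Fatou's lemma
    obtain ⟨B, hB⟩ := hpow hn1
    calc ∫⁻ x in P, v x ^ ((n : ℝ) / (n - 1)) ∂ν
        = ∫⁻ x in P, liminf (fun i => u (φ i) x ^ ((n : ℝ) / (n - 1))) atTop ∂ν :=
          lintegral_congr_ae (hint.mono fun x hx =>
            ((ENNReal.continuous_rpow_const.tendsto _).comp (hlim x hx)).liminf_eq.symm)
      _ ≤ liminf (fun i => ∫⁻ x in P, u (φ i) x ^ ((n : ℝ) / (n - 1)) ∂ν) atTop :=
          lintegral_liminf_le' fun i => (hmeas (φ i)).pow_const _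
      _ ≤ B := liminf_le_of_le (by isBoundedDefault) fun b hb' => by
          obtain ⟨i, hi⟩ := hb'.exists
          exact hi.trans (hB (φ i))
      _ < ∞ := ENNReal.coe_lt_top
  · exact eqOn_of_ae_eq hPol hv hvc hw hwc hvtop
      ((hLp p hp).ae_eq (ne_top_and_toReal_mul_lt hn hp).1 (ne_top_and_toReal_mul_lt hn hp).1 h)
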